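/- **Setting.** Let $d\in\{2,3\}$, let $\Omega\subset\mathbb{R}^d$ be a bounded domain (nonempty, open, connected), and let $\epsilon>0$; $H_\epsilon(\mathbf{x})$ is the ball of radius $\epsilon$ about $\mathbf{x}$ and $\omega_d$ the volume of the unit ball. Let $J:\mathbb{R}\to[0,\infty)$ be bounded and measurable with $J>0$ on $(0,1)$ and $J=0$ on $(1,\infty)$. Let $g:\mathbb{R}\to\mathbb{R}$ be three times differentiable with $g,g',g'',g'''$ bounded, $g(0)=0$, $g(r)>0$ for $r\neq0$, finite limits at $\pm\infty$, $\max|g''|=g''(0)$, and, for some $r^e<0<r^c$, $g$ convex on $[r^e,r^c]$ with $g''>0$ on $(r^e,r^c)$, and $g$ concave on $(-\infty,r^e]$ and on $[r^c,\infty)$. For $\mathbf{x}\ne\mathbf{y}$ put $\mathbf{e}_{\mathbf{y}-\mathbf{x}}=\frac{\mathbf{y}-\mathbf{x}}{|\mathbf{y}-\mathbf{x}|}$ and $S(\mathbf{y},\mathbf{x},\mathbf{u})=\frac{\mathbf{u}(\mathbf{y})-\mathbf{u}(\mathbf{x})}{|\mathbf{y}-\mathbf{x}|}\cdot\mathbf{e}_{\mathbf{y}-\mathbf{x}}$.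 On $L^\infty(\Omega;\mathbb{R}^d)$ with the norm $\|\mathbf u\|_\infty=\operatorname{ess\,sup}_\Omega|\mathbf u|$ define $$\mathcal{L}[\mathbf{u}](\mathbf{x})=-\int_{H_\epsilon(\mathbf{x})\cap\Omega}\frac{2J(|\mathbf{y}-\mathbf{x}|/\epsilon)}{\epsilon^{d+1}\omega_d\sqrt{|\mathbf{y}-\mathbf{x}|}}\,g'\!\left(\sqrt{|\mathbf{y}-\mathbf{x}|}\,S(\mathbf{y},\mathbf{x},\mathbf{u})\right)\mathbf{e}_{\mathbf{y}-\mathbf{x}}\,d\mathbf{y},$$ and, for a load $\mathbf{b}_0$, $$E[\mathbf{u}]=\int_\Omega\int_{H_\epsilon(\mathbf{x})\cap\Omega}\frac{J(|\mathbf{y}-\mathbf{x}|/\epsilon)}{\epsilon^{d+1}\omega_d}\,g\!\left(\sqrt{|\mathbf{y}-\mathbf{x}|}\,S(\mathbf{y},\mathbf{x},\mathbf{u})\right)d\mathbf{y}\,d\mathbf{x}-\int_\Omega\mathbf{u}\cdot\mathbf{b}_0\,d\mathbf{x}.$$ A critical point of $E$ is a $\mathbf{u}\in L^\infty(\Omega;\mathbb{R}^d)$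 at which the Fréchet derivative of $E$ exists and vanishes. Let $\mathcal{V}$ be the space of all $\mathbf{u}\in L^\infty(\Omega;\mathbb{R}^d)$ with $\int_\Omega\mathbf{u}\cdot\mathbf{w}\,d\mathbf{x}=0$ for every rigid motion $\mathbf{w}(\mathbf{x})=\mathbf{Q}\mathbf{x}+\mathbf{c}$, $\mathbf{Q}^T=-\mathbf{Q}$. The strength domain consists of the $\mathbf{u}\in L^\infty(\Omega;\mathbb{R}^d)$ with $\sqrt{|\mathbf{y}-\mathbf{x}|}\,S(\mathbf{y},\mathbf{x},\mathbf{u})\in(r^e,r^c)$ for a.e. $(\mathbf{x},\mathbf{y})\in\Omega\times\Omega$ with $|\mathbf{y}-\mathbf{x}|<\epsilon$; $\mathbf{u}$ lies strictly inside it if these values lie, for a.e. such pair, in one closed interval contained in $(r^e,r^c)$. Let $B(\mathbf{v},R)$ be the closed $\|\cdot\|_\infty$-ball. $\Omega$ satisfies the interior cone condition if there are $\lambda>0$ and $\theta\in(0,\pi/2)$ such that every $\mathbf{x}\in\Omega$ is the apex of a spherical cone of radius $\lambda$ and aperture angle $2\theta$ contained in $\Omega$. **Theorem.** Suppose that $\Omega$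 satisfies the interior cone condition, that $\mathbf{u}_0,\mathbf{b}_0\in\mathcal{V}$, and that $\mathbf{u}_0$ lies strictly inside the strength domain and is a critical point of $E$ for the load $\mathbf{b}_0$. Then $\mathcal{L}:L^\infty(\Omega;\mathbb{R}^d)\to L^\infty(\Omega;\mathbb{R}^d)$ is Fréchet differentiable at $\mathbf{u}_0$, its derivative $D(\mathcal{L})[\mathbf{u}_0]$ maps $\mathcal{V}$ bijectively onto $\mathcal{V}$ with a bounded inverse $D(\mathcal{L})[\mathbf{u}_0]^{-1}$ on $\mathcal{V}$, of operator norm $|||D(\mathcal{L})[\mathbf{u}_0]^{-1}|||$, and there is $R_0>0$ such that for every $R\in(0,R_0]$ the following holds. 1. For every $T\ge0$ and every continuous load path $\mathbf{b}:[0,T]\to\mathcal{V}$ with $\mathbf{b}(t)\in B\!\left(\mathbf{b}_0,\frac{R}{2|||D(\mathcal{L})[\mathbf{u}_0]^{-1}|||}\right)$ for all $t$, there is a unique continuous path $\mathbf{u}:[0,T]\to\mathcal{V}$ with $\mathbf{u}(t)\in B(\mathbf{u}_0,R)$ and $\mathcal{L}[\mathbf{u}(t)]=\mathbf{b}(t)$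 for all $t\in[0,T]$. 2. $\mathbf{u}_0$ is the only critical point of $E$ (for the load $\mathbf{b}_0$) among the $\mathbf{u}\in\mathcal{V}\cap B(\mathbf{u}_0,R)$ in the strength domain. 3. $E[\mathbf{u}]\ge E[\mathbf{u}_0]$ for every $\mathbf{u}\in B(\mathbf{u}_0,R)$ in the strength domain, and equality holds for such a $\mathbf{u}\in\mathcal{V}$ only if $\mathbf{u}=\mathbf{u}_0$. -/

import Mathlib

open MeasureTheory Set Filter Topology
open scoped ENNReal RealInnerProductSpace

noncomputable section

/-- `d`-dimensional Euclidean space. -/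
abbrev Vec (d : ℕ) : Type := EuclideanSpace ℝ (Fin d)

/-- The data of the cohesive bond-based peridynamic model: a bounded domain `Ω` in `ℝ²` or `ℝ³`,
a horizon `ε`, an influence function `J` and a force potential `g` which is convex between the
critical strains `re < 0 < rc` and concave outside. -/
structure CohesiveBody (d : ℕ) where
  dim : d = 2 ∨ d = 3
  Ω : Set (Vec d)
  isOpen_Ω : IsOpen Ω
  isConnected_Ω : IsConnected Ω
  isBounded_Ω : Bornology.IsBounded Ω
  ε : ℝ
  ε_pos : 0 < ε
  J : ℝ → ℝ
  J_measurable : Measurable J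
  J_nonneg : ∀ r, 0 ≤ J r
  J_bounded : ∃ C, ∀ r, J r ≤ C
  J_pos : ∀ r, 0 < r → r < 1 → 0 < J r
  J_zero : ∀ r, 1 < r → J r = 0
  g : ℝ → ℝ
  g_diff : ∀ k < 3, Differentiable ℝ (iteratedDeriv k g)
  g_bounded : ∀ k ≤ 3, ∃ C, ∀ r, |iteratedDeriv k g r| ≤ C
  g_zero : g 0 = 0
  g_pos : ∀ r, r ≠ 0 → 0 < g r
  re : ℝ
  rc : ℝ
  re_neg : re < 0
  rc_pos : 0 < rc
  g_convex : ConvexOn ℝ (Icc re rc) g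
  g_deriv2_pos : ∀ r, re < r → r < rc → 0 < iteratedDeriv 2 g r
  g_concave_left : ConcaveOn ℝ (Iic re) g
  g_concave_right : ConcaveOn ℝ (Ici rc) g
  g_lim_bot : ∃ C, Tendsto g atBot (𝓝 C)
  g_lim_top : ∃ C, Tendsto g atTop (𝓝 C)
  g_deriv2_max : ∀ r, |iteratedDeriv 2 g r| ≤ iteratedDeriv 2 g 0

/-- The unit vector `e_{y-x}`. -/
def bondDir {d : ℕ} (y x : Vec d) : Vec d := ‖y - x‖⁻¹ • (y - x)

/-- The nonlocal strain `S(y, x, u)`. -/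
def bondStrain {d : ℕ} (y x : Vec d) (u : Vec d → Vec d) : ℝ :=
  ⟪‖y - x‖⁻¹ • (u y - u x), bondDir y x⟫

/-- The finite spherical cone with apex `x`, axis `e` (a unit vector), radius `l` and aperture
angle `2 * θ`. -/
def finiteCone {d : ℕ} (x e : Vec d) (l θ : ℝ) : Set (Vec d) :=
  {y | ‖y - x‖ ≤ l ∧ ‖y - x‖ * Real.cos θ ≤ ⟪y - x, e⟫}

/-- The interior cone condition: every point of `Ω` is the apex of a cone contained in `Ω`, with
radius and aperture angle independent of the point. -/
def InteriorConeCondition {d : ℕ} (Ω : Set (Vec d)) : Prop :=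
  ∃ θ l : ℝ, 0 < θ ∧ θ < Real.pi / 2 ∧ 0 < l ∧
    ∀ x ∈ Ω, ∃ e : Vec d, ‖e‖ = 1 ∧ finiteCone x e l θ ⊆ Ω

/-- The rigid motions `x ↦ Q x + c` with `Q` skew-symmetric. -/
def rigidMotions (d : ℕ) : Set (Vec d → Vec d) :=
  {w | ∃ (Q : Matrix (Fin d) (Fin d) ℝ) (c : Vec d), Q.transpose = -Q ∧
    w = fun x => Matrix.toEuclideanLin Q x + c}

namespace CohesiveBody

variable {d : ℕ} (M : CohesiveBody d)

/-- Lebesgue measure on `Ω`. -/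
def μ : Measure (Vec d) := volume.restrict M.Ω

instance : IsFiniteMeasure M.μ :=
  ⟨by rw [μ, Measure.restrict_apply_univ]; exact M.isBounded_Ω.measure_lt_top⟩

/-- The space `L^∞(Ω; ℝ^d)` with the essential supremum norm. -/
abbrev Linf : Type := Lp (Vec d) ∞ M.μ

/-- The volume of the unit ball of `ℝ^d`. -/
def ω (_M : CohesiveBody d) : ℝ := (volume (Metric.ball (0 : Vec d) 1)).toReal

/-- The integrand of the peridynamic force operator at `x`. -/
def forceKernel (u : Vec d → Vec d) (x y : Vec d) : Vec d :=
  (2 * M.J (‖y - x‖ / M.ε) / (M.ε ^ (d + 1) * M.ω * √‖y - x‖) *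
    deriv M.g (√‖y - x‖ * bondStrain y x u)) • bondDir y x

/-- The peridynamic force `𝓛[u](x)` as a function of the point `x`. -/
def force (u : Vec d → Vec d) (x : Vec d) : Vec d :=
  -∫ y in Metric.ball x M.ε ∩ M.Ω, M.forceKernel u x y

theorem measurable_forceKernel {u : Vec d → Vec d} (hu : Measurable u) :
    Measurable (fun p : Vec d × Vec d => M.forceKernel u p.1 p.2) := by
  have hJ := M.J_measurable
  have hg : Measurable (deriv M.g) := measurable_deriv M.g
  unfold forceKernel bondStrain bondDir
  fun_prop

theorem integrable_bound (K : ℝ) :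
    Integrable (fun z : Vec d => (Metric.ball (0 : Vec d) M.ε).indicator
      (fun z => K / √‖z‖) z) := by
  have hd : 2 ≤ d := by rcases M.dim with h | h <;> omega
  have : Nontrivial (Vec d) := by
    apply Module.nontrivial_of_finrank_pos (R := ℝ)
    rw [finrank_euclideanSpace_fin]; omega
  rw [integrable_indicator_iff Metric.isOpen_ball.measurableSet]
  have := (integrableOn_fun_norm_addHaar (volume : Measure (Vec d))
    (f := fun y : ℝ => K / √y) (r := M.ε))
  rw [this, finrank_euclideanSpace_fin]
  have hc : IntegrableOn (fun y : ℝ => K * (y ^ (d - 2) * √y)) (Ioo 0 M.ε) := by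
    refine IntegrableOn.mono_set (t := Icc 0 M.ε) ?_ Ioo_subset_Icc_self
    exact (by fun_prop : Continuous fun y : ℝ => K * (y ^ (d - 2) * √y)).integrableOn_Icc
  refine hc.congr_fun (fun y hy => ?_) measurableSet_Ioo
  have hy0 : 0 < √y := Real.sqrt_pos.2 hy.1
  have h2 : d - 1 = (d - 2) + 1 := by omega
  have hs : y = √y * √y := (Real.mul_self_sqrt hy.1.le).symm
  simp only [smul_eq_mul]
  rw [h2, pow_succ]
  field_simp
  rw [Real.sq_sqrt hy.1.le]

theorem norm_bondDir_le {y x : Vec d} : ‖bondDir y x‖ ≤ 1 := by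
  unfold bondDir
  rw [norm_smul, norm_inv, norm_norm]
  exact inv_mul_le_one

theorem exists_forceKernel_bound : ∃ K : ℝ, ∀ (u : Vec d → Vec d) (x y : Vec d),
    ‖M.forceKernel u x y‖ ≤ K / √‖y - x‖ := by
  obtain ⟨CJ, hCJ⟩ := M.J_bounded
  obtain ⟨Cg, hCg⟩ := M.g_bounded 1 (by norm_num)
  have hCJ0 : 0 ≤ CJ := (M.J_nonneg 0).trans (hCJ 0)
  have hω : 0 ≤ M.ω := ENNReal.toReal_nonneg
  have hε : 0 ≤ M.ε ^ (d + 1) := (pow_pos M.ε_pos _).le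
  refine ⟨2 * CJ / (M.ε ^ (d + 1) * M.ω) * Cg, fun u x y => ?_⟩
  unfold forceKernel
  rw [norm_smul, norm_mul]
  have h1 : ‖2 * M.J (‖y - x‖ / M.ε) / (M.ε ^ (d + 1) * M.ω * √‖y - x‖)‖
      ≤ 2 * CJ / (M.ε ^ (d + 1) * M.ω * √‖y - x‖) := by
    have := M.J_nonneg (‖y - x‖ / M.ε)
    rw [Real.norm_of_nonneg (by positivity)]
    have := hCJ (‖y - x‖ / M.ε)
    gcongr
  have h2 : ‖deriv M.g (√‖y - x‖ * bondStrain y x u)‖ ≤ Cg := by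
    have := hCg (√‖y - x‖ * bondStrain y x u)
    rwa [iteratedDeriv_one] at this
  calc _ ≤ 2 * CJ / (M.ε ^ (d + 1) * M.ω * √‖y - x‖) * Cg * 1 := by
        have hCg0 : 0 ≤ Cg := (norm_nonneg _).trans h2
        have := M.J_nonneg 0
        exact mul_le_mul (mul_le_mul h1 h2 (norm_nonneg _) (by positivity)) norm_bondDir_le
          (norm_nonneg _) (by positivity)
    _ = _ := by rw [mul_one, div_mul_eq_div_div, div_mul_eq_mul_div]

/-- The force of a displacement in `L^∞` is again in `L^∞`. -/
theorem memLp_force {u : Vec d → Vec d} (hu : Measurable u) : MemLp (M.force u) ∞ M.μ := by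
  obtain ⟨K, hK⟩ := M.exists_forceKernel_bound
  set S : Set (Vec d × Vec d) := {p | dist p.2 p.1 < M.ε} with hS
  have hSm : MeasurableSet S := measurableSet_lt (by fun_prop) measurable_const
  have hm : Measurable (S.indicator fun p : Vec d × Vec d => M.forceKernel u p.1 p.2) :=
    (M.measurable_forceKernel hu).indicator hSm
  have heq : M.force u = fun x => -∫ y, S.indicator (fun p => M.forceKernel u p.1 p.2) (x, y)
      ∂M.μ := by
    funext x
    unfold force
    rw [← Measure.restrict_restrict Metric.isOpen_ball.measurableSet,
      ← integral_indicator Metric.isOpen_ball.measurableSet]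
    rfl
  have hsm : StronglyMeasurable (M.force u) := by
    rw [heq]
    exact (StronglyMeasurable.integral_prod_right (ν := M.μ)
      (f := fun x y => S.indicator (fun p => M.forceKernel u p.1 p.2) (x, y))
      hm.stronglyMeasurable).neg
  have hint := M.integrable_bound K
  refine memLp_top_of_bound hsm.aestronglyMeasurable
    (∫ z, (Metric.ball (0 : Vec d) M.ε).indicator (fun z => K / √‖z‖) z) (ae_of_all _ fun x => ?_)
  have hpt : ∀ y, ‖S.indicator (fun p => M.forceKernel u p.1 p.2) (x, y)‖ ≤
      (Metric.ball (0 : Vec d) M.ε).indicator (fun z => K / √‖z‖) (y - x) := by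
    intro y
    by_cases h : dist y x < M.ε
    · rw [indicator_of_mem (by simpa [hS] using h),
        indicator_of_mem (by simpa [dist_eq_norm] using h)]
      exact hK u x y
    · rw [indicator_of_notMem (by simpa [hS] using h),
        indicator_of_notMem (by simpa [dist_eq_norm] using h), norm_zero]
  have hnn : ∀ y, 0 ≤ (Metric.ball (0 : Vec d) M.ε).indicator (fun z => K / √‖z‖) (y - x) :=
    fun y => (norm_nonneg _).trans (hpt y)
  have hint' := hint.comp_sub_right x
  rw [heq]
  simp only [norm_neg]
  calc _ ≤ ∫ y, (Metric.ball (0 : Vec d) M.ε).indicator (fun z => K / √‖z‖) (y - x) ∂M.μ :=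
        norm_integral_le_of_norm_le hint'.restrict (ae_of_all _ hpt)
    _ ≤ ∫ y, (Metric.ball (0 : Vec d) M.ε).indicator (fun z => K / √‖z‖) (y - x) :=
        setIntegral_le_integral hint' (ae_of_all _ hnn)
    _ = _ := integral_sub_right_eq_self _ x

/-- The peridynamic force operator on `L^∞(Ω; ℝ^d)`. -/
def L (u : M.Linf) : M.Linf := (M.memLp_force (Lp.stronglyMeasurable u).measurable).toLp

theorem integrable_inner_rigid (u : M.Linf) {w : Vec d → Vec d} (hw : w ∈ rigidMotions d) :
    Integrable (fun x => ⟪u x, w x⟫) M.μ := by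
  obtain ⟨Q, c, -, rfl⟩ := hw
  have hc : Continuous fun x : Vec d => Matrix.toEuclideanLin Q x + c :=
    (LinearMap.continuous_of_finiteDimensional _).add continuous_const
  obtain ⟨C, hC⟩ := (M.isBounded_Ω.isCompact_closure.image hc).isBounded.exists_norm_le
  have hw : MemLp (fun x : Vec d => Matrix.toEuclideanLin Q x + c) 2 M.μ := by
    refine MemLp.of_bound hc.aestronglyMeasurable C ?_
    refine (ae_restrict_mem M.isOpen_Ω.measurableSet).mono fun x hx => ?_
    exact hC _ ⟨x, subset_closure hx, rfl⟩
  have hu : MemLp u 2 M.μ := (Lp.memLp u).mono_exponent le_top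
  refine (hu.norm.integrable_mul hw.norm).mono (hu.1.inner hw.1) (ae_of_all _ fun x => ?_)
  simpa using abs_real_inner_le_norm (u x) (Matrix.toEuclideanLin Q x + c)

/-- The space `𝓥` of displacements in `L^∞(Ω; ℝ^d)` that are orthogonal to all rigid motions. -/
def V : Submodule ℝ M.Linf where
  carrier := {u | ∀ w ∈ rigidMotions d, ∫ x, ⟪u x, w x⟫ ∂M.μ = 0}
  zero_mem' := by
    intro w _
    refine integral_eq_zero_of_ae ?_
    filter_upwards [Lp.coeFn_zero (Vec d) ∞ M.μ] with x hx
    change ⟪(0 : M.Linf) x, w x⟫ = 0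
    rw [hx, Pi.zero_apply, inner_zero_left]
  add_mem' := by
    intro u v hu hv w hw
    have : (fun x => ⟪(u + v) x, w x⟫) =ᵐ[M.μ] fun x => ⟪u x, w x⟫ + ⟪v x, w x⟫ := by
      filter_upwards [Lp.coeFn_add u v] with x hx
      rw [hx, Pi.add_apply, inner_add_left]
    rw [integral_congr_ae this, integral_add (M.integrable_inner_rigid u hw)
      (M.integrable_inner_rigid v hw), hu w hw, hv w hw, add_zero]
  smul_mem' := by
    intro c u hu w hw
    have : (fun x => ⟪(c • u) x, w x⟫) =ᵐ[M.μ] fun x => c * ⟪u x, w x⟫ := by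
      filter_upwards [Lp.coeFn_smul c u] with x hx
      rw [hx, Pi.smul_apply, real_inner_smul_left]
    rw [integral_congr_ae this, integral_const_mul, hu w hw, mul_zero]

/-- The nonlocal potential `W(S(y, x, u))` of the bond between `x` and `y`. -/
def potential (u : Vec d → Vec d) (x y : Vec d) : ℝ :=
  M.J (‖y - x‖ / M.ε) / (M.ε ^ (d + 1) * M.ω * ‖y - x‖) *
    M.g (√‖y - x‖ * bondStrain y x u)

/-- The peridynamic potential energy. -/
def PD (u : M.Linf) : ℝ :=
  ∫ x in M.Ω, ∫ y in Metric.ball x M.ε ∩ M.Ω, ‖y - x‖ * M.potential u x y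

/-- The total energy under the load `b`. -/
def E (b u : M.Linf) : ℝ := M.PD u - ∫ x in M.Ω, ⟪u x, b x⟫

/-- `u` is a critical point of the total energy under the load `b`: the Fréchet derivative of the
energy on `L^∞(Ω; ℝ^d)` exists and vanishes at `u`. -/
def IsCriticalPoint (b u : M.Linf) : Prop :=
  HasFDerivAt (M.E b) (0 : M.Linf →L[ℝ] ℝ) u

/-- The strength domain: displacements all of whose scaled bond strains lie in `(re, rc)`. -/
def strengthDomain : Set M.Linf :=
  {u | ∀ᵐ p ∂(M.μ.prod M.μ), dist p.2 p.1 < M.ε →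
    √‖p.2 - p.1‖ * bondStrain p.2 p.1 u ∈ Ioo M.re M.rc}

/-- `u` lies strictly inside the strength domain: all scaled bond strains lie in one closed
interval contained in `(re, rc)`. -/
def StrictlyInsideStrengthDomain (u : M.Linf) : Prop :=
  ∃ r₁ r₂ : ℝ, M.re < r₁ ∧ r₂ < M.rc ∧
    ∀ᵐ p ∂(M.μ.prod M.μ), dist p.2 p.1 < M.ε →
      √‖p.2 - p.1‖ * bondStrain p.2 p.1 u ∈ Icc r₁ r₂

end CohesiveBody

end

open MeasureTheory Set Filter Topology
open scoped ENNReal RealInnerProductSpace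

/-! The force is smooth on `L^∞` because scaled strains are only mildly singular. A displacement of
norm r has strain at most 2r|y-x|^(-1/2), so the force kernel, its linearisation and its
second-order Taylor remainder have singularities |y-x|^(-1/2), |y-x|^(-1) and |y-x|^(-3/2), all
integrable since d ≥ 2. As g'' is Lipschitz, `exists_norm_L_sub_sub_le` shows that on the ball of
radius R about u₀ the force differs from its linearisation by a map with Lipschitz constant CR. This
gives both Fréchet differentiability and the estimate needed for inversion.

The linearisation is A - K, where A multiplies by the matrix obtained by integrating the stiffness
kernel and K is the integral operator with that kernel (`exists_linearization`). Strictly inside the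
strength domain g'' is bounded below, and the cone condition supplies bonds in enough directions
uniformly in x, so A is uniformly elliptic, hence invertible (`exists_ellipticity`,
`isUnit_of_ae_elliptic`). K is compact by Arzelà–Ascoli, although u₀ is merely measurable, because
its kernel depends on x only through the pair (x, u₀(x)) in a compact set, continuously in L¹. The
quadratic form of A - K is a weighted integral of squared strains; it vanishes only on displacements
without strain, which are rigid motions because Ω is connected. The Fredholm alternative then yields
an isomorphism of V (`exists_equiv`), and a quantitative inverse function theorem lifts load paths
(`existsUnique_lift_of_approximatesLinearOn`).

The energy has derivative given by pairing with L[u] - b, so a critical point satisfies L[u] = b.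
Its remainder about u is an integral of tangent gaps of g (`E_sub_E_sub`). In the strength domain
strict convexity makes these gaps nonnegative, and zero only where the strains agree; this gives
minimality and its equality case. -/

noncomputable section

/-! ### Invertibility, Fredholm alternative and lifting of paths in Banach spaces -/

section Abstract

variable {X : Type*} [NormedAddCommGroup X] [NormedSpace ℝ X] [CompleteSpace X]

/-- An operator is invertible as soon as a positive multiple of it is close to the identity. -/
theorem isUnit_of_norm_sub_smul_le (A : X →L[ℝ] X) {t q : ℝ} (ht : t ≠ 0) (hq0 : 0 ≤ q)
    (hq : q < 1) (h : ∀ x, ‖x - t • A x‖ ≤ q * ‖x‖) : IsUnit A := by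
  have h1 : ‖(1 : X →L[ℝ] X) - t • A‖ < 1 :=
    (ContinuousLinearMap.opNorm_le_bound _ hq0 fun x => by simpa using h x).trans_lt hq
  have h2 : IsUnit (t • A) := by simpa using isUnit_one_sub_of_norm_lt_one h1
  have h3 : A = (Units.mk0 t⁻¹ (inv_ne_zero ht)) • (t • A) := by
    rw [Units.smul_def, Units.val_mk0, inv_smul_smul₀ ht]
  rw [h3]
  exact h2.smul _

/-- The Fredholm alternative for a compact perturbation of an invertible operator. -/
theorem bijective_sub_of_isCompactOperator {A K : X →L[ℝ] X} (hA : IsUnit A)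
    (hK : IsCompactOperator K) (hinj : ∀ x, A x = K x → x = 0) :
    Function.Bijective (A - K) := by
  obtain ⟨U, rfl⟩ := hA
  set T : X →L[ℝ] X := (↑U⁻¹ : X →L[ℝ] X) * K
  have hT : IsCompactOperator T := hK.clm_comp (↑U⁻¹ : X →L[ℝ] X)
  have hUU : ∀ x, (U : X →L[ℝ] X) ((↑U⁻¹ : X →L[ℝ] X) x) = x := fun x => by
    rw [← mul_apply_eq_comp, Units.mul_inv, one_apply_eq_self]
  -- With T = U⁻¹K one has U - K = U(1 - T). Since T is compact, 1 is either an eigenvalue, which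
  -- injectivity excludes, or in the resolvent set.
  rcases hT.hasEigenvalue_or_mem_resolventSet one_ne_zero with h | h
  · obtain ⟨x, hx⟩ := h.exists_hasEigenvector
    refine absurd (hinj x ?_) hx.2
    have h1 : T x = x := by simpa using hx.apply_eq_smul
    calc (U : X →L[ℝ] X) x = (U : X →L[ℝ] X) (T x) := by rw [h1]
      _ = K x := hUU _
  · rw [spectrum.mem_resolventSet_iff, map_one] at h
    have h2 : (U : X →L[ℝ] X) - K = U * (1 - T) := by
      rw [mul_sub, mul_one, Units.mul_inv_cancel_left]
    rw [h2]
    exact ContinuousLinearMap.isUnit_iff_bijective.1 (U.isUnit.mul h)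

/-- A map that is close to an isomorphism `A` on a closed ball lifts continuous paths near the
image of the centre, uniquely, and is injective on the ball. -/
theorem existsUnique_lift_of_approximatesLinearOn {Z : Type*} [TopologicalSpace Z] {f : X → X}
    {A : X ≃L[ℝ] X} {u₀ : X} {R c : ℝ} (hR : 0 < R) (hc0 : 0 ≤ c)
    (hc : c * ‖(A.symm : X →L[ℝ] X)‖ ≤ 1 / 2)
    (hf : ∀ u v, ‖u - u₀‖ ≤ R → ‖v - u₀‖ ≤ R → ‖f u - f v - A (u - v)‖ ≤ c * ‖u - v‖) :
    (∀ u v, ‖u - u₀‖ ≤ R → ‖v - u₀‖ ≤ R → f u = f v → u = v) ∧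
    ∀ b : C(Z, X), (∀ t, ‖b t - f u₀‖ ≤ R / (2 * ‖(A.symm : X →L[ℝ] X)‖)) →
      ∃! u : C(Z, X), (∀ t, ‖u t - u₀‖ ≤ R) ∧ ∀ t, f (u t) = b t := by
  set N := ‖(A.symm : X →L[ℝ] X)‖ with hN
  have hN0 : 0 ≤ N := norm_nonneg _
  have anti : ∀ u v, ‖u - u₀‖ ≤ R → ‖v - u₀‖ ≤ R → ‖u - v‖ ≤ 2 * N * ‖f u - f v‖ := by
    intro u v hu hv
    have h1 : ‖u - v‖ ≤ N * ‖A (u - v)‖ := by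
      simpa using (A.symm : X →L[ℝ] X).le_opNorm (A (u - v))
    have h2 : ‖A (u - v)‖ ≤ ‖f u - f v‖ + c * ‖u - v‖ := by
      calc ‖A (u - v)‖ = ‖(f u - f v) - (f u - f v - A (u - v))‖ := by congr 1; abel
        _ ≤ _ := (norm_sub_le _ _).trans (by gcongr; exact hf u v hu hv)
    -- Since cN ≤ 1/2, the error term is at most half of ‖u - v‖ and is absorbed on the left; hence
    -- the factor 2.
    have h3 := mul_le_mul_of_nonneg_left h2 hN0
    nlinarith [mul_le_mul_of_nonneg_right hc (norm_nonneg (u - v))]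
  have inj : ∀ u v, ‖u - u₀‖ ≤ R → ‖v - u₀‖ ≤ R → f u = f v → u = v := by
    intro u v hu hv huv
    have := anti u v hu hv
    rw [huv, sub_self, norm_zero, mul_zero] at this
    exact sub_eq_zero.1 (norm_le_zero_iff.1 this)
  refine ⟨inj, fun b hb => ?_⟩
  have ex : ∀ t, ∃ u, ‖u - u₀‖ ≤ R ∧ f u = b t := by
    intro t
    -- If N = 0, the radius R / (2 * N) is 0 by the convention for division, so b t = f u₀ and the
    -- centre itself is a solution.
    rcases hN0.eq_or_lt with h0 | hpos
    · refine ⟨u₀, by simpa using hR.le, ?_⟩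
      have := hb t
      rw [← h0, mul_zero, div_zero] at this
      exact (sub_eq_zero.1 (norm_le_zero_iff.1 this)).symm
    · have happ : ApproximatesLinearOn f (A : X →L[ℝ] X) (Metric.closedBall u₀ R) ⟨c, hc0⟩ := by
        intro u hu v hv
        exact hf u v (by simpa [dist_eq_norm] using hu) (by simpa [dist_eq_norm] using hv)
      have hs := happ.surjOn_closedBall_of_nonlinearRightInverse
        A.toNonlinearRightInverse hR.le subset_rfl
      -- The image of the ball covers radius (N⁻¹ - c)R, which is at least R / (2N) because c ≤ 1 /
      -- (2N). This is the source of the load radius in the theorem.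
      have hmem : b t ∈ Metric.closedBall (f u₀)
          (((A.toNonlinearRightInverse.nnnorm : ℝ)⁻¹ - (⟨c, hc0⟩ : NNReal)) * R) := by
        rw [mem_closedBall_iff_norm]
        refine (hb t).trans ?_
        change R / (2 * N) ≤ (N⁻¹ - c) * R
        have : c ≤ 1 / 2 / N := by rwa [le_div_iff₀ hpos]
        calc R / (2 * N) = (N⁻¹ - 1 / 2 / N) * R := by field_simp; ring
          _ ≤ _ := by gcongr
      obtain ⟨u, hu, hfu⟩ := hs hmem
      exact ⟨u, by simpa [dist_eq_norm] using hu, hfu⟩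
  choose u hu hfu using ex
  have hcont : Continuous u := by
    refine continuous_iff_continuousAt.2 fun t => ?_
    rw [ContinuousAt, tendsto_iff_norm_sub_tendsto_zero]
    have hlim : Tendsto (fun s => 2 * N * ‖b s - b t‖) (𝓝 t) (𝓝 0) := by
      have : Continuous fun s => 2 * N * ‖b s - b t‖ := by fun_prop
      simpa using this.tendsto t
    refine squeeze_zero (fun _ => norm_nonneg _) (fun s => ?_) hlim
    have := anti (u s) (u t) (hu s) (hu t)
    rwa [hfu, hfu] at this
  refine ⟨⟨u, hcont⟩, ⟨hu, hfu⟩, fun v hv => ?_⟩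
  ext t
  exact inj _ _ (hv.1 t) (hu t) ((hv.2 t).trans (hfu t).symm)

end Abstract

/-! ### A Taylor estimate -/

section Taylor

/-- First-order Taylor estimate, at a base point other than the two end points. -/
theorem abs_sub_sub_mul_le {φ φ' : ℝ → ℝ} {C : ℝ} (hφ : ∀ r, HasDerivAt φ (φ' r) r)
    (hφ' : ∀ r s, |φ' r - φ' s| ≤ C * |r - s|) (s t s₀ m : ℝ) (hs : |s - s₀| ≤ m)
    (ht : |t - s₀| ≤ m) : |φ s - φ t - φ' s₀ * (s - t)| ≤ C * m * |s - t| := by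
  have hC : 0 ≤ C := by simpa using (abs_nonneg _).trans (hφ' 1 0)
  -- The mean value inequality for φ(r) - φ'(s₀)r, whose derivative is at most Cm within distance m
  -- of s₀.
  have key := (convex_closedBall s₀ m).norm_image_sub_le_of_norm_hasDerivWithin_le
    (f := fun r => φ r - φ' s₀ * r) (f' := fun r => φ' r - φ' s₀ * 1) (C := C * m)
    (fun r _ => ((hφ r).sub ((hasDerivAt_id r).const_mul (φ' s₀))).hasDerivWithinAt)
    (fun r hr => by
      rw [mul_one, Real.norm_eq_abs]
      exact (hφ' r s₀).trans (by gcongr; simpa [Real.dist_eq] using hr))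
    (x := t) (y := s) (by simpa [Real.dist_eq] using ht) (by simpa [Real.dist_eq] using hs)
  rw [Real.norm_eq_abs, Real.norm_eq_abs] at key
  convert key using 2
  ring

end Taylor

/-! ### Displacements without strain -/

section Rigid

variable {d : ℕ}

/-- No differentiability of w is needed. Let S be the subspace of directions v for which ⟪w y, v⟫ is
a.e. affine in y. Subtracting the identity at x₀ from the identity at x cancels ⟪w y, y⟫ and shows x
- x₀ ∈ S for a.e. x in B. A proper subspace is null and B is not, so S is everything and all
coordinates of w are affine. -/
theorem ae_eq_linear_add_const_of_isOpen {B : Set (Vec d)} (hB : IsOpen B) (hne : B.Nonempty)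
    {w : Vec d → Vec d} (h : ∀ᵐ x ∂(volume.restrict B), ∀ᵐ y ∂(volume.restrict B),
      ⟪w y - w x, y - x⟫ = 0) :
    ∃ (Q : Vec d →ₗ[ℝ] Vec d) (c : Vec d), (∀ v, ⟪Q v, v⟫ = 0) ∧
      ∀ᵐ y ∂(volume.restrict B), w y = Q y + c := by
  set ν : Measure (Vec d) := volume.restrict B
  have hν : ν ≠ 0 := by
    rw [Ne, Measure.restrict_eq_zero]
    exact (hB.measure_pos volume hne).ne'
  have : NeZero ν := ⟨hν⟩
  let S : Submodule ℝ (Vec d) :=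
    { carrier := {v | ∃ (p : Vec d) (c : ℝ), ∀ᵐ y ∂ν, ⟪w y, v⟫ = ⟪p, y⟫ + c}
      zero_mem' := ⟨0, 0, by simp⟩
      add_mem' := by
        rintro v v' ⟨p, c, hp⟩ ⟨p', c', hp'⟩
        refine ⟨p + p', c + c', ?_⟩
        filter_upwards [hp, hp'] with y h1 h2
        rw [inner_add_right, h1, h2, inner_add_left]; ring
      smul_mem' := by
        rintro a v ⟨p, c, hp⟩
        refine ⟨a • p, a * c, ?_⟩
        filter_upwards [hp] with y h1
        rw [real_inner_smul_right, h1, real_inner_smul_left]; ring }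
  obtain ⟨x₀, hx₀⟩ := h.exists
  have hS : S = ⊤ := by
    by_contra hS
    have h0 := Measure.addHaar_submodule (volume : Measure (Vec d)) S hS
    have h1 : ∀ᵐ x ∂ν, x - x₀ ∈ S := by
      filter_upwards [h] with x hx
      refine ⟨w x₀ - w x, ⟪w x, x⟫ - ⟪w x₀, x₀⟫, ?_⟩
      filter_upwards [hx, hx₀] with y h1 h2
      simp only [inner_sub_left, inner_sub_right] at h1 h2 ⊢
      linarith
    have h2 : volume ((fun x => x - x₀) ⁻¹' (S : Set (Vec d))) = 0 := by
      simpa [sub_eq_add_neg, measure_preimage_add_right] using h0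
    have h3 : ∀ᵐ x ∂ν, x - x₀ ∉ S := ae_restrict_of_ae (measure_eq_zero_iff_ae_notMem.1 h2)
    obtain ⟨x, hx, hx'⟩ := (h1.and h3).exists
    exact hx' hx
  have hmem : ∀ i : Fin d, EuclideanSpace.single i (1 : ℝ) ∈ S := fun i => by rw [hS]; trivial
  choose p c hpc using hmem
  let Q : Vec d →ₗ[ℝ] Vec d := ∑ i, (innerₛₗ ℝ (p i)).smulRight (EuclideanSpace.single i (1 : ℝ))
  have hQ : ∀ y i, Q y i = ⟪p i, y⟫ := by
    intro y i
    simp only [Q, LinearMap.sum_apply, LinearMap.smulRight_apply, innerₛₗ_apply_apply]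
    rw [WithLp.ofLp_sum, Finset.sum_apply]
    simp
  have hw : ∀ᵐ y ∂ν, w y = Q y + WithLp.toLp 2 c := by
    filter_upwards [ae_all_iff.2 hpc] with y hy
    ext i
    have := hy i
    simp only [EuclideanSpace.inner_single_right] at this
    simp [hQ, ← this]
  refine ⟨Q, WithLp.toLp 2 c, fun v => ?_, hw⟩
  have hQc : Continuous Q := LinearMap.continuous_of_finiteDimensional _
  have h4 : ∀ᵐ x ∂ν, ∀ᵐ y ∂ν, ⟪Q (y - x), y - x⟫ = 0 := by
    filter_upwards [h, hw] with x hx hwx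
    filter_upwards [hx, hw] with y hy hwy
    rwa [hwx, hwy, add_sub_add_right_eq_sub, ← map_sub] at hy
  obtain ⟨x, hx, hxB⟩ := (h4.and (ae_restrict_mem hB.measurableSet)).exists
  have h5 : EqOn (fun y => ⟪Q (y - x), y - x⟫) (fun _ => (0 : ℝ)) B :=
    Measure.eqOn_open_of_ae_eq hx hB (by fun_prop) (by fun_prop)
  -- Every direction v occurs, after scaling by a small t ≠ 0, as a difference of points of B; the
  -- factor t² is then divided out.
  have h6 : ∀ᶠ t : ℝ in 𝓝[≠] 0, x + t • v ∈ B := by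
    have : Tendsto (fun t : ℝ => x + t • v) (𝓝 0) (𝓝 x) := by
      have : Continuous fun t : ℝ => x + t • v := by fun_prop
      simpa using this.tendsto 0
    exact (this.eventually (hB.mem_nhds hxB)).filter_mono nhdsWithin_le_nhds
  obtain ⟨t, ht, ht0⟩ := (h6.and self_mem_nhdsWithin).exists
  have h7 := h5 ht
  simp only [add_sub_cancel_left, map_smul, real_inner_smul_left, real_inner_smul_right] at h7
  have ht0 : t ≠ 0 := ht0
  simpa [ht0] using h7

/-- Unique continuation for affine maps: a.e. agreement on an open set becomes agreement there by
continuity, and any y is reached by extrapolating along a segment that starts in U. -/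
theorem linear_add_const_eq_of_isOpen {U : Set (Vec d)} (hU : IsOpen U) (hne : U.Nonempty)
    {Q Q' : Vec d →ₗ[ℝ] Vec d} {c c' : Vec d}
    (h : ∀ᵐ y ∂(volume.restrict U), Q y + c = Q' y + c') (y : Vec d) : Q y + c = Q' y + c' := by
  have hQ : Continuous Q := LinearMap.continuous_of_finiteDimensional _
  have hQ' : Continuous Q' := LinearMap.continuous_of_finiteDimensional _
  have h5 : EqOn (fun y => Q y + c) (fun y => Q' y + c') U :=
    Measure.eqOn_open_of_ae_eq h hU (by fun_prop) (by fun_prop)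
  obtain ⟨x, hx⟩ := hne
  have h6 : ∀ᶠ t : ℝ in 𝓝[≠] 0, x + t • (y - x) ∈ U := by
    have : Tendsto (fun t : ℝ => x + t • (y - x)) (𝓝 0) (𝓝 x) := by
      have : Continuous fun t : ℝ => x + t • (y - x) := by fun_prop
      simpa using this.tendsto 0
    exact (this.eventually (hU.mem_nhds hx)).filter_mono nhdsWithin_le_nhds
  obtain ⟨t, ht, ht0⟩ := (h6.and self_mem_nhdsWithin).exists
  have ht0 : t ≠ 0 := ht0
  have h7 := h5 ht
  have h8 := h5 hx
  simp only [map_add, map_smul] at h7 h8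
  have h9 : t • Q (y - x) = t • Q' (y - x) := by
    have e : t • Q (y - x) = (Q x + t • Q (y - x) + c) - (Q x + c) := by abel
    rw [e, h7, h8]; abel
  have h10 := smul_right_injective _ ht0 h9
  simp only [map_sub] at h10
  calc Q y + c = (Q y - Q x) + (Q x + c) := by abel
    _ = _ := by rw [h10, h8]; abel

/-- A displacement without nonlocal strain on a connected open set is a rigid motion. -/
theorem ae_eq_rigid_of_ae_inner_eq_zero {Ω : Set (Vec d)} (hΩ : IsOpen Ω) (hc : IsConnected Ω)
    {ε : ℝ} (hε : 0 < ε) {w : Vec d → Vec d}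
    (h : ∀ᵐ x ∂(volume.restrict Ω), ∀ᵐ y ∂(volume.restrict Ω), dist y x < ε →
      ⟪w y - w x, y - x⟫ = 0) :
    ∃ r ∈ rigidMotions d, ∀ᵐ x ∂(volume.restrict Ω), w x = r x := by
  have loc : ∀ x ∈ Ω, ∃ U, IsOpen U ∧ x ∈ U ∧
      ∃ (Q : Vec d →ₗ[ℝ] Vec d) (c : Vec d), (∀ v, ⟪Q v, v⟫ = 0) ∧
      ∀ᵐ y ∂(volume.restrict U), w y = Q y + c := by
    intro x hx
    obtain ⟨r, hr, hrΩ⟩ := Metric.isOpen_iff.1 hΩ x hx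
    -- Any two points of a ball of radius at most ε / 2 are closer than ε, so the strain condition
    -- applies to all pairs in it.
    set ρ := min r (ε / 2)
    have hρ : 0 < ρ := lt_min hr (by positivity)
    have hsub : Metric.ball x ρ ⊆ Ω := (Metric.ball_subset_ball (min_le_left _ _)).trans hrΩ
    refine ⟨Metric.ball x ρ, Metric.isOpen_ball, Metric.mem_ball_self hρ,
      ae_eq_linear_add_const_of_isOpen Metric.isOpen_ball ⟨x, Metric.mem_ball_self hρ⟩ ?_⟩
    filter_upwards [ae_restrict_of_ae_restrict_of_subset hsub h,
      ae_restrict_mem Metric.isOpen_ball.measurableSet] with a ha haB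
    filter_upwards [ae_restrict_of_ae_restrict_of_subset hsub ha,
      ae_restrict_mem Metric.isOpen_ball.measurableSet] with b hb hbB
    apply hb
    have h1 := Metric.mem_ball.1 haB
    have h2 := Metric.mem_ball.1 hbB
    have h3 : ρ ≤ ε / 2 := min_le_right _ _
    linarith [dist_triangle_right b a x]
  choose! U hUo hxU hU using loc
  obtain ⟨x₀, hx₀⟩ := hc.nonempty
  obtain ⟨Q, c, hQ, hQw⟩ := hU x₀ hx₀
  have key : ∀ x ∈ Ω, ∃ V, IsOpen V ∧ x ∈ V ∧ ∀ᵐ y ∂(volume.restrict V), w y = Q y + c := by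
    -- G is the open set of points near which w is the affine map found at x₀. Near a point of Ω in
    -- the closure of G the local affine map agrees with that one on an overlap, hence everywhere,
    -- so connectedness gives Ω ⊆ G.
    let G : Set (Vec d) :=
      {x | ∃ V, IsOpen V ∧ x ∈ V ∧ ∀ᵐ y ∂(volume.restrict V), w y = Q y + c}
    have hG : IsOpen G := isOpen_iff_forall_mem_open.2 fun x ⟨V, hV, hxV, hw⟩ =>
      ⟨V, fun z hz => ⟨V, hV, hz, hw⟩, hV, hxV⟩
    refine hc.isPreconnected.subset_of_closure_inter_subset hG
      ⟨x₀, hx₀, U x₀, hUo x₀ hx₀, hxU x₀ hx₀, hQw⟩ ?_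
    rintro x ⟨hxG, hx⟩
    obtain ⟨z, hzU, V, hV, hzV, hw⟩ := mem_closure_iff.1 hxG _ (hUo x hx) (hxU x hx)
    obtain ⟨Q', c', -, hw'⟩ := hU x hx
    have heq := linear_add_const_eq_of_isOpen ((hUo x hx).inter hV) ⟨z, hzU, hzV⟩
      (Q := Q') (Q' := Q) (c := c') (c' := c) (by
        filter_upwards [ae_restrict_of_ae_restrict_of_subset inter_subset_left hw',
          ae_restrict_of_ae_restrict_of_subset inter_subset_right hw] with y h1 h2
        rw [← h1, ← h2])
    exact ⟨U x, hUo x hx, hxU x hx, hw'.mono fun y hy => hy.trans (heq y)⟩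
  refine ⟨fun x => Q x + c, ⟨LinearMap.toMatrix
    (EuclideanSpace.basisFun (Fin d) ℝ).toBasis (EuclideanSpace.basisFun (Fin d) ℝ).toBasis Q, c,
    ?_, ?_⟩, ?_⟩
  · have hskew : ∀ u v, ⟪Q u, v⟫ = -⟪Q v, u⟫ := by
      intro u v
      have := hQ (u + v)
      simp only [map_add, inner_add_left, inner_add_right, hQ] at this
      linarith
    ext i j
    have := hskew (EuclideanSpace.single i 1) (EuclideanSpace.single j 1)
    simpa [LinearMap.toMatrix_apply, EuclideanSpace.inner_single_right] using this
  · funext x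
    congr 1
    rw [Matrix.toEuclideanLin_eq_toLin_orthonormal, Matrix.toLin_toMatrix]
  · rw [ae_iff, Measure.restrict_apply₀' hΩ.measurableSet.nullMeasurableSet]
    refine measure_null_of_locally_null _ fun x hx => ?_
    obtain ⟨V, hV, hxV, hw⟩ := key x hx.2
    refine ⟨{a | ¬w a = Q a + c} ∩ V, ?_, ?_⟩
    · exact inter_mem (mem_of_superset self_mem_nhdsWithin inter_subset_left)
        (mem_nhdsWithin_of_mem_nhds (hV.mem_nhds hxV))
    · rwa [← Measure.restrict_apply₀' hV.measurableSet.nullMeasurableSet]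

end Rigid

/-! ### The essential supremum norm and the L² pairing -/

section EssentiallyBounded

variable {α F : Type*} [MeasurableSpace α] {μ : Measure α} [NormedAddCommGroup F]

theorem Linf_ae_norm_le (f : Lp F ∞ μ) : ∀ᵐ x ∂μ, ‖f x‖ ≤ ‖f‖ := by
  filter_upwards [ae_le_eLpNormEssSup (f := f) (μ := μ)] with x hx
  rw [Lp.norm_def, eLpNorm_exponent_top, ← toReal_enorm]
  refine ENNReal.toReal_mono ?_ hx
  rw [← eLpNorm_exponent_top]
  exact Lp.eLpNorm_ne_top f

theorem Linf_norm_le {f : Lp F ∞ μ} {C : ℝ} (hC : 0 ≤ C) (h : ∀ᵐ x ∂μ, ‖f x‖ ≤ C) :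
    ‖f‖ ≤ C := by
  rw [Lp.norm_def, eLpNorm_exponent_top]
  exact ENNReal.toReal_le_of_le_ofReal hC (eLpNormEssSup_le_of_ae_bound h)

variable [InnerProductSpace ℝ F]

theorem Linf_integrable_inner [IsFiniteMeasure μ] (f g : Lp F ∞ μ) :
    Integrable (fun x => ⟪f x, g x⟫) μ := by
  refine Integrable.of_bound ((Lp.aestronglyMeasurable f).inner (Lp.aestronglyMeasurable g))
    (‖f‖ * ‖g‖) ?_
  filter_upwards [Linf_ae_norm_le f, Linf_ae_norm_le g] with x hf hg
  exact (norm_inner_le_norm _ _).trans (by gcongr)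

/-- The `L²` pairing on `L^∞` of a finite measure space. -/
def LinfPairing [IsFiniteMeasure μ] (f : Lp F ∞ μ) : Lp F ∞ μ →L[ℝ] ℝ :=
  LinearMap.mkContinuous
    { toFun := fun g => ∫ x, ⟪f x, g x⟫ ∂μ
      map_add' := fun g h => by
        rw [← integral_add (Linf_integrable_inner f g) (Linf_integrable_inner f h)]
        refine integral_congr_ae ?_
        filter_upwards [Lp.coeFn_add g h] with x hx
        rw [hx, Pi.add_apply, inner_add_right]
      map_smul' := fun c g => by
        rw [RingHom.id_apply, smul_eq_mul, ← integral_const_mul]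
        refine integral_congr_ae ?_
        filter_upwards [Lp.coeFn_smul c g] with x hx
        rw [hx, Pi.smul_apply, real_inner_smul_right] }
    (‖f‖ * μ.real univ) fun g => by
      have : ‖∫ x, ⟪f x, g x⟫ ∂μ‖ ≤ ‖f‖ * ‖g‖ * μ.real univ :=
        norm_integral_le_of_norm_le_const (by
          filter_upwards [Linf_ae_norm_le f, Linf_ae_norm_le g] with x hf hg
          exact (norm_inner_le_norm _ _).trans (by gcongr))
      simpa [mul_right_comm] using this

variable [IsFiniteMeasure μ]

theorem LinfPairing_apply (f g : Lp F ∞ μ) : LinfPairing f g = ∫ x, ⟪f x, g x⟫ ∂μ := rfl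

theorem LinfPairing_comm (f g : Lp F ∞ μ) : LinfPairing f g = LinfPairing g f := by
  simp only [LinfPairing_apply, real_inner_comm]

theorem eq_zero_of_LinfPairing_self {f : Lp F ∞ μ} (h : LinfPairing f f = 0) : f = 0 := by
  have h1 : 0 ≤ᵐ[μ] fun x => ⟪f x, f x⟫ := ae_of_all _ fun x => real_inner_self_nonneg
  have h2 := (integral_eq_zero_iff_of_nonneg_ae h1 (Linf_integrable_inner f f)).1 h
  rw [Lp.eq_zero_iff_ae_eq_zero]
  filter_upwards [h2] with x hx
  exact inner_self_eq_zero.1 hx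

end EssentiallyBounded

/-! ### Multiplication operators and integral operators on essentially bounded functions -/

section Operators

variable {α F : Type*} [MeasurableSpace α] {μ : Measure α} [NormedAddCommGroup F]
  [NormedSpace ℝ F]

theorem Linf_integrable_clm_apply {k : α → F →L[ℝ] F} (hk : Integrable k μ) (w : Lp F ∞ μ) :
    Integrable (fun y => k y (w y)) μ := by
  refine (hk.norm.mul_const ‖w‖).mono' (isBoundedBilinearMap_apply.continuous.comp_aestronglyMeasurable
    (hk.1.prodMk (Lp.aestronglyMeasurable w))) ?_
  filter_upwards [Linf_ae_norm_le w] with y hy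
  exact ((k y).le_opNorm _).trans (by gcongr)

theorem Linf_norm_integral_clm_apply_le {k : α → F →L[ℝ] F} (hk : Integrable k μ)
    (w : Lp F ∞ μ) : ‖∫ y, k y (w y) ∂μ‖ ≤ (∫ y, ‖k y‖ ∂μ) * ‖w‖ := by
  rw [← integral_mul_const]
  refine norm_integral_le_of_norm_le (hk.norm.mul_const _) ?_
  filter_upwards [Linf_ae_norm_le w] with y hy
  exact ((k y).le_opNorm _).trans (by gcongr)

/-- A linear operator on `L^∞` given almost everywhere by a pointwise formula. -/
theorem exists_clm_of_ae_eq {G : (α → F) → α → F} {C : ℝ} (hC : 0 ≤ C)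
    (hm : ∀ w : Lp F ∞ μ, AEStronglyMeasurable (G w) μ)
    (hb : ∀ w : Lp F ∞ μ, ∀ᵐ x ∂μ, ‖G w x‖ ≤ C * ‖w‖)
    (hadd : ∀ w w' : Lp F ∞ μ, G ↑(w + w') =ᵐ[μ] fun x => G w x + G w' x)
    (hsmul : ∀ (c : ℝ) (w : Lp F ∞ μ), G ↑(c • w) =ᵐ[μ] fun x => c • G w x) :
    ∃ T : Lp F ∞ μ →L[ℝ] Lp F ∞ μ, ∀ w, T w =ᵐ[μ] G w := by
  have hmem : ∀ w : Lp F ∞ μ, MemLp (G w) ∞ μ := fun w =>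
    memLp_top_of_bound (hm w) _ (hb w)
  refine ⟨LinearMap.mkContinuous
    { toFun := fun w => MemLp.toLp (G w) (hmem w)
      map_add' := fun w w' => by
        rw [← MemLp.toLp_add]
        exact MemLp.toLp_congr _ _ (hadd w w')
      map_smul' := fun c w => by
        rw [RingHom.id_apply, ← MemLp.toLp_const_smul]
        exact MemLp.toLp_congr _ _ (hsmul c w) } C fun w => ?_, fun w => (hmem w).coeFn_toLp⟩
  refine Linf_norm_le (by positivity) ?_
  filter_upwards [(hmem w).coeFn_toLp, hb w] with x hx hx'
  rw [← hx] at hx'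
  exact hx'

theorem exists_clm_mul {a : α → F →L[ℝ] F} (ha : AEStronglyMeasurable a μ) {C : ℝ} (hC : 0 ≤ C)
    (hb : ∀ x, ‖a x‖ ≤ C) :
    ∃ T : Lp F ∞ μ →L[ℝ] Lp F ∞ μ, ∀ w, T w =ᵐ[μ] fun x => a x (w x) := by
  refine exists_clm_of_ae_eq (G := fun w x => a x (w x)) hC
    (fun w => isBoundedBilinearMap_apply.continuous.comp_aestronglyMeasurable
      (ha.prodMk (Lp.aestronglyMeasurable w))) (fun w => ?_) (fun w w' => ?_)
    (fun c w => ?_)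
  · filter_upwards [Linf_ae_norm_le w] with x hx
    exact ((a x).le_opNorm _).trans (mul_le_mul (hb x) hx (norm_nonneg _) hC)
  · filter_upwards [Lp.coeFn_add w w'] with x hx
    rw [hx, Pi.add_apply, map_add]
  · filter_upwards [Lp.coeFn_smul c w] with x hx
    rw [hx, Pi.smul_apply, map_smul]

theorem exists_clm_integral [SFinite μ] {k : α × α → F →L[ℝ] F} (hk : StronglyMeasurable k)
    (hki : ∀ x, Integrable (fun y => k (x, y)) μ) {C : ℝ} (hC : 0 ≤ C)
    (hb : ∀ x, ∫ y, ‖k (x, y)‖ ∂μ ≤ C) :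
    ∃ T : Lp F ∞ μ →L[ℝ] Lp F ∞ μ, ∀ w, T w =ᵐ[μ] fun x => ∫ y, k (x, y) (w y) ∂μ := by
  refine exists_clm_of_ae_eq (G := fun w x => ∫ y, k (x, y) (w y) ∂μ) hC
    (fun w => ?_) (fun w => ae_of_all _ fun x => ?_) (fun w w' => ae_of_all _ fun x => ?_)
    (fun c w => ae_of_all _ fun x => ?_)
  · have : StronglyMeasurable fun p : α × α => k p (w p.2) :=
      isBoundedBilinearMap_apply.continuous.comp_stronglyMeasurable
        (hk.prodMk ((Lp.stronglyMeasurable w).comp_measurable measurable_snd))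
    exact (this.integral_prod_right' (ν := μ)).aestronglyMeasurable
  · exact (Linf_norm_integral_clm_apply_le (hki x) w).trans (by gcongr; exact hb x)
  · change _ = (∫ y, k (x, y) (w y) ∂μ) + ∫ y, k (x, y) (w' y) ∂μ
    rw [← integral_add (Linf_integrable_clm_apply (hki x) w)
      (Linf_integrable_clm_apply (hki x) w')]
    refine integral_congr_ae ?_
    filter_upwards [Lp.coeFn_add w w'] with y hy
    rw [hy, Pi.add_apply, map_add]
  · change _ = c • ∫ y, k (x, y) (w y) ∂μ
    rw [← integral_smul]
    refine integral_congr_ae ?_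
    filter_upwards [Lp.coeFn_smul c w] with y hy
    rw [hy, Pi.smul_apply, map_smul]

/-- An integral operator on `L^∞` whose kernel depends on the point only through a parameter in
a compact set, continuously in `L¹`, is compact. -/
theorem isCompactOperator_integral [FiniteDimensional ℝ F] {Y : Type*} [MetricSpace Y]
    [MeasurableSpace Y] [BorelSpace Y] {X : Set Y} (hX : IsCompact X) {φ : α → Y}
    (hφ : Measurable φ) (hφX : ∀ᵐ x ∂μ, φ x ∈ X) {Λ : Y → α → F →L[ℝ] F}
    (hΛ : ∀ a, Integrable (Λ a) μ) {C : ℝ} (hC : ∀ a, ∫ y, ‖Λ a y‖ ∂μ ≤ C)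
    (hcont : ∀ a, Tendsto (fun a' => ∫ y, ‖Λ a' y - Λ a y‖ ∂μ) (𝓝 a) (𝓝 0))
    {T : Lp F ∞ μ →L[ℝ] Lp F ∞ μ} (hT : ∀ w, T w =ᵐ[μ] fun x => ∫ y, Λ (φ x) y (w y) ∂μ) :
    IsCompactOperator T := by
  have : CompactSpace X := isCompact_iff_compactSpace.1 hX
  have hdiff : ∀ (w : Lp F ∞ μ) a a', ‖(∫ y, Λ a' y (w y) ∂μ) - ∫ y, Λ a y (w y) ∂μ‖ ≤
      (∫ y, ‖Λ a' y - Λ a y‖ ∂μ) * ‖w‖ := by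
    intro w a a'
    rw [← integral_sub (Linf_integrable_clm_apply (hΛ a') w)
      (Linf_integrable_clm_apply (hΛ a) w)]
    exact Linf_norm_integral_clm_apply_le ((hΛ a').sub (hΛ a)) w
  have hc : ∀ w : Lp F ∞ μ, Continuous fun a : X => ∫ y, Λ a y (w y) ∂μ := by
    intro w
    refine Continuous.comp (g := fun a : Y => ∫ y, Λ a y (w y) ∂μ) ?_ continuous_subtype_val
    refine continuous_iff_continuousAt.2 fun a => ?_
    rw [ContinuousAt, tendsto_iff_norm_sub_tendsto_zero]
    exact squeeze_zero (fun _ => norm_nonneg _) (fun a' => hdiff w a a')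
      (by simpa using (hcont a).mul_const ‖w‖)
  -- T factors as Γ ∘ Ψ: Ψ integrates against the kernel and lands in the continuous functions on X,
  -- and Γ is composition with φ, a Lipschitz map. Compactness is needed only for Ψ, where
  -- Arzelà–Ascoli applies.
  let Ψ : Lp F ∞ μ → BoundedContinuousFunction X F := fun w =>
    BoundedContinuousFunction.mkOfCompact ⟨_, hc w⟩
  have hme : MeasurableEmbedding (Subtype.val : X → Y) :=
    MeasurableEmbedding.subtype_coe hX.isClosed.measurableSet
  -- Since φ lies in X only almost everywhere, f is extended by 0 outside X before composing.
  have hmeas : ∀ f : BoundedContinuousFunction X F,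
      AEStronglyMeasurable (fun x => Function.extend (Subtype.val : X → Y) f 0 (φ x)) μ := by
    intro f
    borelize F
    have : ProperSpace F := FiniteDimensional.proper ℝ F
    exact ((hme.measurable_extend f.continuous.measurable measurable_zero).comp
      hφ).aestronglyMeasurable
  have hext : ∀ (f : BoundedContinuousFunction X F) {x} (hx : φ x ∈ X),
      Function.extend (Subtype.val : X → Y) f 0 (φ x) = f ⟨φ x, hx⟩ := fun f x hx =>
    Subtype.val_injective.extend_apply f 0 ⟨φ x, hx⟩
  have hmem : ∀ f : BoundedContinuousFunction X F,
      MemLp (fun x => Function.extend (Subtype.val : X → Y) f 0 (φ x)) ∞ μ := by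
    intro f
    refine memLp_top_of_bound (hmeas f) ‖f‖ ?_
    filter_upwards [hφX] with x hx
    rw [hext f hx]
    exact f.norm_coe_le_norm _
  let Γ : BoundedContinuousFunction X F → Lp F ∞ μ := fun f => (hmem f).toLp
  have hΓ : LipschitzWith 1 Γ := by
    refine LipschitzWith.of_dist_le_mul fun f f' => ?_
    rw [NNReal.coe_one, one_mul, dist_eq_norm]
    refine Linf_norm_le dist_nonneg ?_
    filter_upwards [Lp.coeFn_sub (Γ f) (Γ f'), (hmem f).coeFn_toLp, (hmem f').coeFn_toLp, hφX]
      with x h1 h2 h3 hx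
    rw [h1, Pi.sub_apply, h2, h3, hext f hx, hext f' hx, ← dist_eq_norm]
    exact BoundedContinuousFunction.dist_coe_le_dist _
  have hTΓ : ∀ w, T w = Γ (Ψ w) := by
    intro w
    refine Lp.ext ?_
    filter_upwards [hT w, (hmem (Ψ w)).coeFn_toLp, hφX] with x h1 h2 hx
    rw [h1, h2, hext _ hx]
    rfl
  have hproper : ProperSpace F := FiniteDimensional.proper ℝ F
  have hcpt : IsCompact (closure (Ψ '' Metric.closedBall 0 1)) := by
    refine BoundedContinuousFunction.arzela_ascoli (Metric.closedBall 0 C)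
      (isCompact_closedBall _ _) _ ?_ ?_
    · rintro f x ⟨w, hw, rfl⟩
      rw [mem_closedBall_zero_iff] at hw ⊢
      have h1 : (∫ y, ‖Λ x y‖ ∂μ) * ‖w‖ ≤ (∫ y, ‖Λ x y‖ ∂μ) * 1 := by
        gcongr
      exact ((Linf_norm_integral_clm_apply_le (hΛ x) w).trans h1).trans
        (by simpa using hC x)
    · intro a
      rw [Metric.equicontinuousAt_iff]
      intro ε hε
      have h1 := ((hcont a).comp (continuous_subtype_val.tendsto a)).eventually (gt_mem_nhds hε)
      obtain ⟨δ, hδ, h⟩ := Metric.eventually_nhds_iff.1 h1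
      refine ⟨δ, hδ, fun a' ha' => ?_⟩
      rintro ⟨_, w, hw, rfl⟩
      rw [mem_closedBall_zero_iff] at hw
      rw [dist_comm, dist_eq_norm]
      have h2 : (∫ y, ‖Λ a' y - Λ a y‖ ∂μ) * ‖w‖ ≤ (∫ y, ‖Λ a' y - Λ a y‖ ∂μ) * 1 := by
        gcongr
      exact ((hdiff w a a').trans h2).trans_lt (by simpa using h ha')
  refine ⟨_, hcpt.image hΓ.continuous, ?_⟩
  refine mem_of_superset (Metric.closedBall_mem_nhds (0 : Lp F ∞ μ) one_pos) fun w hw => ?_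
  exact ⟨Ψ w, subset_closure ⟨w, hw, rfl⟩, (hTΓ w).symm⟩

end Operators

/-! ### Continuity of translation in L¹ -/

section Translation

/-- Translations are measure preserving and depend continuously on x' in the compact-open topology,
so composition with them is continuous in L¹. -/
theorem tendsto_integral_norm_sub_translate {d : ℕ} {F : Type*} [NormedAddCommGroup F]
    {f : Vec d → F} (hf : Integrable f) (x : Vec d) :
    Tendsto (fun x' => ∫ y, ‖f (y - x') - f (y - x)‖) (𝓝 x) (𝓝 0) := by
  have hmp : ∀ x' : Vec d, MeasurePreserving
      (⟨fun y => y - x', by fun_prop⟩ : C(Vec d, Vec d)) volume volume := fun x' =>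
    measurePreserving_sub_right volume x'
  have hg : Tendsto (fun x' => (⟨fun y => y - x', by fun_prop⟩ : C(Vec d, Vec d))) (𝓝 x)
      (𝓝 ⟨fun y => y - x, by fun_prop⟩) := by
    have hc : Continuous fun p : Vec d × Vec d => p.2 - p.1 := by fun_prop
    exact (ContinuousMap.curry ⟨_, hc⟩).continuous.tendsto x
  have hlim := Filter.Tendsto.compMeasurePreservingLp
    (tendsto_const_nhds (x := (memLp_one_iff_integrable.2 hf).toLp)) hg hmp (hmp x)
    ENNReal.one_ne_top
  rw [tendsto_iff_norm_sub_tendsto_zero] at hlim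
  refine hlim.congr fun x' => ?_
  rw [Lp.toLp_compMeasurePreserving, Lp.toLp_compMeasurePreserving, ← MemLp.toLp_sub]
  exact L1.norm_of_fun_eq_integral_norm
    (((hf.comp_sub_right x')).sub (hf.comp_sub_right x))

end Translation

/-! ### Nonlocal integration by parts -/

section Antisymmetry

variable {α F : Type*} [MeasurableSpace α] {μ : Measure α} [IsFiniteMeasure μ]
  [NormedAddCommGroup F] [InnerProductSpace ℝ F] [CompleteSpace F]

/-- Exchanging x and y turns the integral of ⟪f, φ(y)⟫ into minus that of ⟪f, φ(x)⟫, so both halves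
of the difference contribute equally. -/
theorem integral_inner_sub_of_antisymm {f : α × α → F} (hf : Integrable f (μ.prod μ))
    (anti : ∀ p, f p.swap = -f p) {φ : α → F} (hφ : AEStronglyMeasurable φ μ) {C : ℝ}
    (hC : ∀ᵐ x ∂μ, ‖φ x‖ ≤ C) :
    Integrable (fun p => ⟪f p, φ p.2 - φ p.1⟫) (μ.prod μ) ∧
    ∫ p, ⟪f p, φ p.2 - φ p.1⟫ ∂(μ.prod μ) = -2 * ∫ x, ⟪∫ y, f (x, y) ∂μ, φ x⟫ ∂μ := by
  have h1 : Integrable (fun p : α × α => ⟪f p, φ p.1⟫) (μ.prod μ) := by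
    refine (hf.norm.mul_const C).mono' (hf.1.inner hφ.comp_fst) ?_
    filter_upwards [Measure.quasiMeasurePreserving_fst.ae hC] with p hp
    exact (norm_inner_le_norm _ _).trans (by gcongr)
  have h2 : (fun p : α × α => ⟪f p, φ p.2⟫) = fun p => -(fun p => ⟪f p, φ p.1⟫) p.swap := by
    funext p
    simp [anti p]
  have h3 : Integrable (fun p : α × α => ⟪f p, φ p.2⟫) (μ.prod μ) := by
    rw [h2]; exact h1.swap.neg
  have h4 : ∫ p, ⟪f p, φ p.2⟫ ∂(μ.prod μ) = -∫ p, ⟪f p, φ p.1⟫ ∂(μ.prod μ) := by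
    rw [h2, integral_neg, integral_prod_swap (fun p : α × α => ⟪f p, φ p.1⟫)]
  have h5 : ∫ p, ⟪f p, φ p.1⟫ ∂(μ.prod μ) = ∫ x, ⟪∫ y, f (x, y) ∂μ, φ x⟫ ∂μ := by
    rw [integral_prod _ h1]
    refine integral_congr_ae ?_
    filter_upwards [hf.prod_right_ae] with x hx
    simp only [real_inner_comm (φ x)]
    exact integral_inner hx (φ x)
  simp only [inner_sub_right]
  refine ⟨h3.sub h1, ?_⟩
  rw [integral_sub h3 h1, h4, h5]
  ring

end Antisymmetry

theorem StrictConvexOn.add_mul_sub_lt {S : Set ℝ} {f : ℝ → ℝ} {x y f' : ℝ}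
    (hf : StrictConvexOn ℝ S f) (hx : x ∈ S) (hy : y ∈ S) (hne : x ≠ y)
    (hd : HasDerivAt f f' x) : f x + f' * (y - x) < f y := by
  rcases hne.lt_or_gt with h | h
  · have := hf.lt_slope_of_hasDerivAt hx hy h hd
    rw [slope_def_field, lt_div_iff₀ (sub_pos.2 h)] at this
    linarith
  · have := hf.slope_lt_of_hasDerivAt hy hx h hd
    rw [slope_def_field, div_lt_iff₀ (sub_pos.2 h)] at this
    linarith

/-! ### Bond directions and scaled strains -/

theorem bondDir_swap {d : ℕ} (x y : Vec d) : bondDir x y = -bondDir y x := by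
  unfold bondDir
  rw [← smul_neg, neg_sub, norm_sub_rev]

theorem measurable_bondDir {d : ℕ} : Measurable fun p : Vec d × Vec d => bondDir p.2 p.1 := by
  unfold bondDir
  fun_prop

/-- The bond strain scaled by the square root of the bond length. -/
def scaledStrain {d : ℕ} (u : Vec d → Vec d) (p : Vec d × Vec d) : ℝ :=
  √‖p.2 - p.1‖ * bondStrain p.2 p.1 u

section Strain

variable {d : ℕ} {u v : Vec d → Vec d}

/-- This form exposes the singularity: against a bounded u the strain costs only |y-x|^(-1/2). On
the diagonal both sides are 0 by the conventions for roots and inverses. -/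
theorem scaledStrain_eq (p : Vec d × Vec d) :
    scaledStrain u p = (√‖p.2 - p.1‖)⁻¹ * ⟪u p.2 - u p.1, bondDir p.2 p.1⟫ := by
  unfold scaledStrain bondStrain
  rw [real_inner_smul_left, ← mul_assoc]
  congr 1
  rcases (norm_nonneg (p.2 - p.1)).eq_or_lt with h | h
  · rw [← h]; simp
  · have h1 := Real.sqrt_pos.2 h
    have h2 := Real.mul_self_sqrt h.le
    field_simp
    nlinarith

theorem abs_scaledStrain_le (p : Vec d × Vec d) :
    |scaledStrain u p| ≤ (√‖p.2 - p.1‖)⁻¹ * ‖u p.2 - u p.1‖ := by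
  rw [scaledStrain_eq, abs_mul, abs_of_nonneg (by positivity)]
  gcongr
  exact (abs_real_inner_le_norm _ _).trans
    (mul_le_of_le_one_right (norm_nonneg _) CohesiveBody.norm_bondDir_le)

theorem scaledStrain_swap (p : Vec d × Vec d) : scaledStrain u p.swap = scaledStrain u p := by
  rw [scaledStrain_eq, scaledStrain_eq, Prod.fst_swap, Prod.snd_swap, bondDir_swap, norm_sub_rev,
    ← neg_sub (u p.2), inner_neg_neg]

theorem measurable_scaledStrain (hu : Measurable u) : Measurable (scaledStrain u) := by
  unfold scaledStrain bondStrain bondDir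
  fun_prop

theorem scaledStrain_sub (p : Vec d × Vec d) :
    scaledStrain (fun x => u x - v x) p = scaledStrain u p - scaledStrain v p := by
  simp only [scaledStrain_eq, ← mul_sub, ← inner_sub_left]
  congr 2
  abel

theorem scaledStrain_rigid {w : Vec d → Vec d} (hw : w ∈ rigidMotions d) (p : Vec d × Vec d) :
    scaledStrain w p = 0 := by
  obtain ⟨Q, c, hQ, rfl⟩ := hw
  have skew : ∀ v : Vec d, ⟪Matrix.toEuclideanLin Q v, v⟫ = 0 := by
    intro v
    have h1 : ⟪Matrix.toEuclideanLin Q v, v⟫ = v.ofLp ⬝ᵥ Q.mulVec v.ofLp := by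
      simp [EuclideanSpace.inner_eq_star_dotProduct, Matrix.toLpLin_apply]
    have h2 : v.ofLp ⬝ᵥ Q.mulVec v.ofLp = -(v.ofLp ⬝ᵥ Q.mulVec v.ofLp) := by
      conv_lhs => rw [Matrix.dotProduct_mulVec, ← Matrix.mulVec_transpose, hQ, Matrix.neg_mulVec,
        neg_dotProduct, dotProduct_comm]
    rw [h1]; linarith
  rw [scaledStrain_eq, add_sub_add_right_eq_sub, ← map_sub]
  unfold bondDir
  rw [real_inner_smul_right, skew, mul_zero, mul_zero]

theorem inner_eq_zero_of_scaledStrain_eq_zero {p : Vec d × Vec d} (h : scaledStrain u p = 0) :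
    ⟪u p.2 - u p.1, p.2 - p.1⟫ = 0 := by
  by_cases h0 : p.2 - p.1 = 0
  · rw [h0, inner_zero_right]
  · have h1 : 0 < ‖p.2 - p.1‖ := norm_pos_iff.2 h0
    have h2 := (Real.sqrt_pos.2 h1).ne'
    rw [scaledStrain_eq] at h
    unfold bondDir at h
    rw [real_inner_smul_right] at h
    simpa [h1.ne', h2] using h

end Strain

/-! ### The integrable weight of bonds, and force and energy as integrals over Ω -/

namespace CohesiveBody

variable {d : ℕ} (M : CohesiveBody d)

theorem two_le_dim {d : ℕ} (M : CohesiveBody d) : 2 ≤ d := by rcases M.dim with h | h <;> omega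

theorem nontrivial_vec {d : ℕ} (M : CohesiveBody d) : Nontrivial (Vec d) := by
  apply Module.nontrivial_of_finrank_pos (R := ℝ)
  rw [finrank_euclideanSpace_fin]
  have := M.two_le_dim
  omega

theorem ω_pos : 0 < M.ω :=
  ENNReal.toReal_pos (Metric.measure_ball_pos volume _ one_pos).ne' measure_ball_lt_top.ne

/-- The normalised influence function, as a function of the bond vector. -/
def bondDensity (z : Vec d) : ℝ :=
  (Metric.ball (0 : Vec d) M.ε).indicator (fun z => M.J (‖z‖ / M.ε) / (M.ε ^ (d + 1) * M.ω)) z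

/-- An integrable function of the bond vector dominating all kernels that occur. -/
def bondWeight (z : Vec d) : ℝ :=
  M.bondDensity z * ((√‖z‖)⁻¹ + (√‖z‖)⁻¹ ^ 2 + (√‖z‖)⁻¹ ^ 3)

theorem bondDensity_nonneg (z : Vec d) : 0 ≤ M.bondDensity z :=
  indicator_nonneg (fun _ _ => div_nonneg (M.J_nonneg _)
    (mul_nonneg (pow_nonneg M.ε_pos.le _) M.ω_pos.le)) z

theorem bondWeight_nonneg (z : Vec d) : 0 ≤ M.bondWeight z :=
  mul_nonneg (M.bondDensity_nonneg z) (by positivity)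

theorem measurable_bondDensity : Measurable M.bondDensity := by
  have hJ := M.J_measurable
  exact Measurable.indicator (by fun_prop) Metric.isOpen_ball.measurableSet

theorem measurable_bondWeight : Measurable M.bondWeight := by
  have := M.measurable_bondDensity
  unfold bondWeight
  fun_prop

theorem bondDensity_neg (z : Vec d) : M.bondDensity (-z) = M.bondDensity z := by
  simp [bondDensity, indicator]

theorem bondDensity_swap (p : Vec d × Vec d) :
    M.bondDensity (p.swap.2 - p.swap.1) = M.bondDensity (p.2 - p.1) := by
  rw [← M.bondDensity_neg, neg_sub, Prod.fst_swap, Prod.snd_swap]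

theorem bondDensity_of_le {z : Vec d} (h : M.ε ≤ ‖z‖) : M.bondDensity z = 0 :=
  indicator_of_notMem (by simpa using h) _

theorem bondDensity_of_lt {z : Vec d} (h : ‖z‖ < M.ε) :
    M.bondDensity z = M.J (‖z‖ / M.ε) / (M.ε ^ (d + 1) * M.ω) :=
  indicator_of_mem (by simpa using h) _

theorem bondDensity_pos {z : Vec d} (h0 : z ≠ 0) (h : ‖z‖ < M.ε) : 0 < M.bondDensity z := by
  rw [bondDensity_of_lt M h]
  have := M.ε_pos
  have := M.ω_pos
  have := M.J_pos (‖z‖ / M.ε) (div_pos (norm_pos_iff.2 h0) M.ε_pos) ((div_lt_one M.ε_pos).2 h)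
  positivity

theorem exists_bondDensity_le : ∃ C, 0 ≤ C ∧ ∀ z, M.bondDensity z ≤ C := by
  obtain ⟨C, hC⟩ := M.J_bounded
  have hC0 : 0 ≤ C := (M.J_nonneg 0).trans (hC 0)
  have := M.ε_pos
  have := M.ω_pos
  refine ⟨C / (M.ε ^ (d + 1) * M.ω), by positivity, fun z => ?_⟩
  rcases lt_or_ge ‖z‖ M.ε with h | h
  · rw [M.bondDensity_of_lt h]
    have := hC (‖z‖ / M.ε)
    gcongr
  · rw [M.bondDensity_of_le h]
    positivity

/-- In polar coordinates the worst term r^(-3/2) meets the Jacobian r^(d-1). With d ≥ 2 this leaves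
r^(-1/2) times a continuous function on [0, ε]. -/
theorem integrable_bondWeight : Integrable M.bondWeight := by
  obtain ⟨C, hC0, hC⟩ := M.exists_bondDensity_le
  have hε := M.ε_pos
  have hd := M.two_le_dim
  have := M.nontrivial_vec
  have hq : IntegrableOn (fun z : Vec d => C * ((√‖z‖)⁻¹ + (√‖z‖)⁻¹ ^ 2 + (√‖z‖)⁻¹ ^ 3))
      (Metric.ball 0 M.ε) := by
    rw [integrableOn_fun_norm_addHaar (volume : Measure (Vec d))
      (f := fun y : ℝ => C * ((√y)⁻¹ + (√y)⁻¹ ^ 2 + (√y)⁻¹ ^ 3)), finrank_euclideanSpace_fin]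
    have h1 : IntegrableOn (fun y : ℝ => y ^ (-(1 / 2) : ℝ)) (Ioo 0 M.ε) :=
      (intervalIntegral.integrableOn_Ioo_rpow_iff hε).2 (by norm_num)
    have hcont : ContinuousOn (fun y : ℝ => C * y ^ (d - 2) * (y + √y + 1)) (Icc 0 M.ε) := by
      fun_prop
    have h2 := h1.continuousOn_mul_of_subset
      (g := fun y : ℝ => C * y ^ (d - 2) * (y + √y + 1)) (K := Icc 0 M.ε) hcont
      isCompact_Icc measurableSet_Ioo Ioo_subset_Icc_self
    refine h2.congr_fun (fun y hy => ?_) measurableSet_Ioo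
    have hy0 : 0 < √y := Real.sqrt_pos.2 hy.1
    have hs : y = √y ^ 2 := (Real.sq_sqrt hy.1.le).symm
    have hd2 : d - 1 = (d - 2) + 1 := by omega
    have hr : y ^ (-(1 / 2) : ℝ) = (√y)⁻¹ := by rw [Real.rpow_neg hy.1.le, Real.sqrt_eq_rpow]
    simp only [smul_eq_mul]
    rw [hr, hd2, pow_succ]
    generalize y ^ (d - 2) = a
    generalize √y = r at *
    subst hs
    field_simp
  rw [← integrable_indicator_iff Metric.isOpen_ball.measurableSet] at hq
  refine hq.mono' M.measurable_bondWeight.aestronglyMeasurable (ae_of_all _ fun z => ?_)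
  rw [Real.norm_of_nonneg (M.bondWeight_nonneg z)]
  unfold bondWeight
  by_cases hz : z ∈ Metric.ball (0 : Vec d) M.ε
  · rw [indicator_of_mem hz]
    gcongr
    exact hC z
  · rw [indicator_of_notMem hz, bondDensity, indicator_of_notMem hz, zero_mul]

theorem integrable_bondWeight_sub (x : Vec d) : Integrable (fun y => M.bondWeight (y - x)) M.μ :=
  (M.integrable_bondWeight.comp_sub_right x).restrict

/-- The total mass of the dominating weight. -/
def bondMass : ℝ := ∫ z, M.bondWeight z

theorem bondMass_nonneg : 0 ≤ M.bondMass := integral_nonneg M.bondWeight_nonneg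

theorem integral_bondWeight_sub_le (x : Vec d) : ∫ y, M.bondWeight (y - x) ∂M.μ ≤ M.bondMass :=
  (setIntegral_le_integral (M.integrable_bondWeight.comp_sub_right x)
    (ae_of_all _ fun _ => M.bondWeight_nonneg _)).trans_eq (integral_sub_right_eq_self _ x)

theorem measurable_bondWeight_prod :
    Measurable fun p : Vec d × Vec d => M.bondWeight (p.2 - p.1) :=
  M.measurable_bondWeight.comp (by fun_prop)

theorem measurable_bondDensity_prod :
    Measurable fun p : Vec d × Vec d => M.bondDensity (p.2 - p.1) :=
  M.measurable_bondDensity.comp (by fun_prop)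

theorem integrable_bondWeight_prod :
    Integrable (fun p : Vec d × Vec d => M.bondWeight (p.2 - p.1)) (M.μ.prod M.μ) := by
  rw [integrable_prod_iff M.measurable_bondWeight_prod.aestronglyMeasurable]
  refine ⟨ae_of_all _ M.integrable_bondWeight_sub, ?_⟩
  refine Integrable.of_bound (C := M.bondMass) ?_ (ae_of_all _ fun x => ?_)
  · exact M.measurable_bondWeight_prod.norm.stronglyMeasurable.integral_prod_right'
      (ν := M.μ) |>.aestronglyMeasurable
  · simp only [Real.norm_of_nonneg (M.bondWeight_nonneg _)]
    rw [Real.norm_of_nonneg (integral_nonneg fun _ => M.bondWeight_nonneg _)]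
    exact M.integral_bondWeight_sub_le x

theorem bondDensity_mul_le (z : Vec d) :
    M.bondDensity z * (√‖z‖)⁻¹ ≤ M.bondWeight z ∧
    M.bondDensity z * (√‖z‖)⁻¹ ^ 2 ≤ M.bondWeight z ∧
    M.bondDensity z * (√‖z‖)⁻¹ ^ 3 ≤ M.bondWeight z := by
  have h0 := M.bondDensity_nonneg z
  have hq : 0 ≤ (√‖z‖)⁻¹ := by positivity
  have h2 : 0 ≤ (√‖z‖)⁻¹ ^ 2 := by positivity
  have h3 : 0 ≤ (√‖z‖)⁻¹ ^ 3 := by positivity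
  refine ⟨?_, ?_, ?_⟩ <;> refine mul_le_mul_of_nonneg_left ?_ h0 <;> linarith

theorem setIntegral_ball_eq {F : Type*} [NormedAddCommGroup F] [NormedSpace ℝ F] (x : Vec d)
    {f f' : Vec d → F} (h1 : ∀ y, ‖y - x‖ < M.ε → f y = f' y)
    (h2 : ∀ y, M.ε ≤ ‖y - x‖ → f' y = 0) :
    ∫ y in Metric.ball x M.ε ∩ M.Ω, f y = ∫ y, f' y ∂M.μ := by
  rw [← Measure.restrict_restrict Metric.isOpen_ball.measurableSet,
    ← integral_indicator Metric.isOpen_ball.measurableSet]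
  refine integral_congr_ae (ae_of_all _ fun y => ?_)
  simp only [indicator, Metric.mem_ball, dist_eq_norm]
  split_ifs with h
  · exact h1 y h
  · exact (h2 y (not_lt.1 h)).symm

theorem force_eq (u : Vec d → Vec d) (x : Vec d) :
    M.force u x = -∫ y, (2 * (M.bondDensity (y - x) * (√‖y - x‖)⁻¹ *
      deriv M.g (scaledStrain u (x, y)))) • bondDir y x ∂M.μ := by
  unfold force
  congr 1
  refine M.setIntegral_ball_eq x (fun y hy => ?_) (fun y hy => ?_)
  · rw [M.bondDensity_of_lt hy]
    unfold forceKernel scaledStrain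
    congr 1
    have := M.ε_pos
    have := M.ω_pos
    rcases (Real.sqrt_nonneg ‖y - x‖).eq_or_lt with h | h
    · simp [← h]
    · field_simp
  · rw [M.bondDensity_of_le hy]
    simp

theorem integrable_energy {u : Vec d → Vec d} (hu : Measurable u) :
    Integrable (fun p : Vec d × Vec d => M.bondDensity (p.2 - p.1) * M.g (scaledStrain u p))
      (M.μ.prod M.μ) := by
  obtain ⟨C, hC0, hC⟩ := M.exists_bondDensity_le
  obtain ⟨G, hG⟩ := M.g_bounded 0 (by norm_num)
  have hg : Measurable M.g := by
    have := (M.g_diff 0 (by norm_num)).continuous.measurable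
    simpa using this
  refine Integrable.of_bound (C := C * G) (M.measurable_bondDensity_prod.mul
    (hg.comp (measurable_scaledStrain hu))).aestronglyMeasurable (ae_of_all _ fun p => ?_)
  rw [norm_mul, Real.norm_of_nonneg (M.bondDensity_nonneg _)]
  exact mul_le_mul (hC _) (by simpa using hG (scaledStrain u p)) (norm_nonneg _) hC0

theorem PD_eq (u : M.Linf) :
    M.PD u = ∫ p, M.bondDensity (p.2 - p.1) * M.g (scaledStrain u p) ∂(M.μ.prod M.μ) := by
  rw [integral_prod _ (M.integrable_energy (Lp.stronglyMeasurable u).measurable)]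
  unfold PD
  change ∫ x, _ ∂M.μ = _
  refine integral_congr_ae (ae_of_all _ fun x => ?_)
  refine M.setIntegral_ball_eq x (fun y hy => ?_) (fun y hy => ?_)
  · change _ = M.bondDensity (y - x) * _
    rw [M.bondDensity_of_lt hy]
    unfold potential scaledStrain
    rcases (norm_nonneg (y - x)).eq_or_lt with h | h
    · simp [← h, M.g_zero]
    · have := M.ε_pos
      have := M.ω_pos
      field_simp
  · simp [M.bondDensity_of_le hy]

/-- The weak form of a nonlocal force: its pairing with a displacement. -/
theorem integral_inner_bondForce {G : Vec d × Vec d → ℝ} (symm : ∀ p, G p.swap = G p)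
    (hint : Integrable (fun p : Vec d × Vec d =>
      M.bondDensity (p.2 - p.1) * (√‖p.2 - p.1‖)⁻¹ * G p) (M.μ.prod M.μ))
    {φ : Vec d → Vec d} (hφ : AEStronglyMeasurable φ M.μ) {C : ℝ} (hC : ∀ᵐ x ∂M.μ, ‖φ x‖ ≤ C) :
    Integrable (fun p : Vec d × Vec d => M.bondDensity (p.2 - p.1) * G p * scaledStrain φ p)
      (M.μ.prod M.μ) ∧
    ∫ x, ⟪-∫ y, (2 * (M.bondDensity (y - x) * (√‖y - x‖)⁻¹ * G (x, y))) • bondDir y x ∂M.μ,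
      φ x⟫ ∂M.μ =
    ∫ p, M.bondDensity (p.2 - p.1) * G p * scaledStrain φ p ∂(M.μ.prod M.μ) := by
  let f : Vec d × Vec d → Vec d := fun p =>
    (2 * (M.bondDensity (p.2 - p.1) * (√‖p.2 - p.1‖)⁻¹ * G p)) • bondDir p.2 p.1
  have hf : Integrable f (M.μ.prod M.μ) := by
    refine (hint.norm.const_mul 2).mono' ((hint.1.const_mul 2).smul
      measurable_bondDir.aestronglyMeasurable) (ae_of_all _ fun p => ?_)
    simp only [f]
    rw [norm_smul, norm_mul, Real.norm_two]
    exact mul_le_of_le_one_right (by positivity) norm_bondDir_le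
  have anti : ∀ p, f p.swap = -f p := by
    intro p
    simp only [f]
    rw [M.bondDensity_swap, symm, ← smul_neg, ← bondDir_swap, Prod.fst_swap, Prod.snd_swap,
      norm_sub_rev]
  have hfe : (fun p : Vec d × Vec d => ⟪f p, φ p.2 - φ p.1⟫) = fun p =>
      2 * (M.bondDensity (p.2 - p.1) * G p * scaledStrain φ p) := by
    funext p
    simp only [f]
    rw [real_inner_smul_left, scaledStrain_eq, real_inner_comm]
    ring
  obtain ⟨h1, h2⟩ := integral_inner_sub_of_antisymm hf anti hφ hC
  rw [hfe] at h1 h2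
  refine ⟨by simpa using h1.const_mul (1 / 2), ?_⟩
  rw [integral_const_mul] at h2
  simp only [inner_neg_left, integral_neg]
  linarith

end CohesiveBody

/-! ### Bounds on the derivatives of g and on strains -/

namespace CohesiveBody

variable {d : ℕ} (M : CohesiveBody d)

section Potential

theorem hasDerivAt_g (r : ℝ) : HasDerivAt M.g (deriv M.g r) r := by
  have := M.g_diff 0 (by norm_num)
  rw [iteratedDeriv_zero] at this
  exact (this r).hasDerivAt

theorem hasDerivAt_deriv_g (r : ℝ) : HasDerivAt (deriv M.g) (iteratedDeriv 2 M.g r) r := by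
  have := M.g_diff 1 (by norm_num)
  rw [iteratedDeriv_one] at this
  rw [show (2 : ℕ) = 1 + 1 from rfl, iteratedDeriv_succ, iteratedDeriv_one]
  exact (this r).hasDerivAt

theorem continuous_deriv2_g : Continuous (iteratedDeriv 2 M.g) :=
  (M.g_diff 2 (by norm_num)).continuous

theorem exists_deriv2_g_bound : ∃ C, 0 ≤ C ∧ ∀ r, |iteratedDeriv 2 M.g r| ≤ C := by
  obtain ⟨C, hC⟩ := M.g_bounded 2 (by norm_num)
  exact ⟨C, (abs_nonneg _).trans (hC 0), hC⟩

theorem exists_lipschitz_g_derivs : ∃ C, 0 ≤ C ∧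
    (∀ r s, |deriv M.g r - deriv M.g s| ≤ C * |r - s|) ∧
    ∀ r s, |iteratedDeriv 2 M.g r - iteratedDeriv 2 M.g s| ≤ C * |r - s| := by
  obtain ⟨C₂, hC₂⟩ := M.g_bounded 2 (by norm_num)
  obtain ⟨C₃, hC₃⟩ := M.g_bounded 3 (by norm_num)
  refine ⟨max C₂ C₃, ((abs_nonneg _).trans (hC₂ 0)).trans (le_max_left _ _), fun r s => ?_,
    fun r s => ?_⟩
  · exact convex_univ.norm_image_sub_le_of_norm_hasDerivWithin_le
      (fun r _ => (M.hasDerivAt_deriv_g r).hasDerivWithinAt)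
      (fun r _ => (hC₂ r).trans (le_max_left _ _)) (mem_univ s) (mem_univ r)
  · refine convex_univ.norm_image_sub_le_of_norm_hasDerivWithin_le
      (f' := iteratedDeriv 3 M.g) (fun r _ => ?_)
      (fun r _ => (hC₃ r).trans (le_max_right _ _)) (mem_univ s) (mem_univ r)
    have := ((M.g_diff 2 (by norm_num)) r).hasDerivAt.hasDerivWithinAt (s := univ)
    rwa [← iteratedDeriv_succ] at this

end Potential

section LinfStrain

theorem measurable_coe (u : M.Linf) : Measurable u := (Lp.stronglyMeasurable u).measurable

theorem ae_abs_scaledStrain_le (w : M.Linf) : ∀ᵐ x ∂M.μ, ∀ᵐ y ∂M.μ,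
    |scaledStrain w (x, y)| ≤ (√‖y - x‖)⁻¹ * (2 * ‖w‖) := by
  filter_upwards [Linf_ae_norm_le w] with x hx
  filter_upwards [Linf_ae_norm_le w] with y hy
  refine (abs_scaledStrain_le _).trans ?_
  gcongr
  exact (norm_sub_le _ _).trans (by linarith)

theorem ae_abs_scaledStrain_le_prod (w : M.Linf) : ∀ᵐ p ∂(M.μ.prod M.μ),
    |scaledStrain w p| ≤ (√‖p.2 - p.1‖)⁻¹ * (2 * ‖w‖) := by
  filter_upwards [Measure.quasiMeasurePreserving_fst.ae (Linf_ae_norm_le w),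
    Measure.quasiMeasurePreserving_snd.ae (Linf_ae_norm_le w)] with p h1 h2
  refine (abs_scaledStrain_le _).trans ?_
  gcongr
  exact (norm_sub_le _ _).trans (by linarith)

theorem ae_scaledStrain_sub (u v : M.Linf) : ∀ᵐ x ∂M.μ, ∀ᵐ y ∂M.μ,
    scaledStrain ↑(u - v) (x, y) = scaledStrain u (x, y) - scaledStrain v (x, y) := by
  filter_upwards [Lp.coeFn_sub u v] with x hx
  filter_upwards [Lp.coeFn_sub u v] with y hy
  rw [← scaledStrain_sub, scaledStrain_eq, scaledStrain_eq]
  simp only [hx, hy, Pi.sub_apply]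

theorem ae_scaledStrain_sub_prod (u v : M.Linf) : ∀ᵐ p ∂(M.μ.prod M.μ),
    scaledStrain ↑(u - v) p = scaledStrain u p - scaledStrain v p := by
  filter_upwards [Measure.quasiMeasurePreserving_fst.ae (Lp.coeFn_sub u v),
    Measure.quasiMeasurePreserving_snd.ae (Lp.coeFn_sub u v)] with p h1 h2
  rw [← scaledStrain_sub, scaledStrain_eq, scaledStrain_eq]
  simp only [h1, h2, Pi.sub_apply]

end LinfStrain

/-! ### The stiffness kernel -/

section Kernel

/-- The operator-valued bond stiffness of the bond vector `z`. -/
def bondTensor (z : Vec d) : Vec d →L[ℝ] Vec d :=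
  (2 * (M.bondDensity z * (√‖z‖)⁻¹ ^ 2)) •
    InnerProductSpace.rankOne ℝ (‖z‖⁻¹ • z) (‖z‖⁻¹ • z)

theorem bondTensor_apply (x y v : Vec d) : M.bondTensor (y - x) v =
    (2 * (M.bondDensity (y - x) * (√‖y - x‖)⁻¹ ^ 2) * ⟪bondDir y x, v⟫) • bondDir y x := by
  rw [bondTensor, smul_apply, InnerProductSpace.rankOne_apply, smul_smul]
  rfl

theorem norm_bondTensor_le (z : Vec d) : ‖M.bondTensor z‖ ≤ 2 * M.bondWeight z := by
  have h0 := M.bondDensity_nonneg z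
  have h1 : ‖‖z‖⁻¹ • z‖ ≤ 1 := by simpa [bondDir] using norm_bondDir_le (y := z) (x := 0)
  rw [bondTensor, norm_smul, InnerProductSpace.norm_rankOne, Real.norm_of_nonneg (by positivity)]
  have h2 : ‖‖z‖⁻¹ • z‖ * ‖‖z‖⁻¹ • z‖ ≤ 1 := mul_le_one₀ h1 (norm_nonneg _) h1
  have h3 := (M.bondDensity_mul_le z).2.1
  exact (mul_le_of_le_one_right (by positivity) h2).trans (by linarith)

theorem stronglyMeasurable_bondTensor : StronglyMeasurable M.bondTensor := by
  have := M.measurable_bondDensity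
  have h1 : StronglyMeasurable fun z : Vec d => 2 * (M.bondDensity z * (√‖z‖)⁻¹ ^ 2) :=
    (by fun_prop : Measurable fun z : Vec d =>
      2 * (M.bondDensity z * (√‖z‖)⁻¹ ^ 2)).stronglyMeasurable
  have h2 : Continuous fun v : Vec d => InnerProductSpace.rankOne ℝ v v :=
    (InnerProductSpace.rankOne ℝ (E := Vec d) (F := Vec d)).continuous.clm_apply continuous_id
  exact h1.smul (h2.comp_stronglyMeasurable
    (by fun_prop : Measurable fun z : Vec d => ‖z‖⁻¹ • z).stronglyMeasurable)

theorem integrable_bondTensor : Integrable M.bondTensor :=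
  (M.integrable_bondWeight.const_mul 2).mono' M.stronglyMeasurable_bondTensor.aestronglyMeasurable
    (ae_of_all _ M.norm_bondTensor_le)

/-- The kernel of the linearised force, with the position and the displacement of the first end
point of the bond as independent parameters. -/
def stiffness (u : Vec d → Vec d) (a : Vec d × Vec d) (y : Vec d) : Vec d →L[ℝ] Vec d :=
  iteratedDeriv 2 M.g ((√‖y - a.1‖)⁻¹ * ⟪u y - a.2, bondDir y a.1⟫) • M.bondTensor (y - a.1)

theorem stiffness_apply (u : Vec d → Vec d) (x y v : Vec d) : M.stiffness u (x, u x) y v =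
    (2 * (M.bondDensity (y - x) * (√‖y - x‖)⁻¹ ^ 2) *
      iteratedDeriv 2 M.g (scaledStrain u (x, y)) * ⟪bondDir y x, v⟫) • bondDir y x := by
  rw [stiffness, smul_apply, bondTensor_apply, smul_smul, scaledStrain_eq]
  congr 1
  ring

variable {u : Vec d → Vec d}

theorem stronglyMeasurable_stiffness (hu : Measurable u) :
    StronglyMeasurable fun q : (Vec d × Vec d) × Vec d => M.stiffness u q.1 q.2 := by
  unfold stiffness
  refine StronglyMeasurable.smul (f := fun q : (Vec d × Vec d) × Vec d =>
    iteratedDeriv 2 M.g ((√‖q.2 - q.1.1‖)⁻¹ * ⟪u q.2 - q.1.2, bondDir q.2 q.1.1⟫)) ?_ ?_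
  · refine M.continuous_deriv2_g.comp_stronglyMeasurable (Measurable.stronglyMeasurable ?_)
    unfold bondDir
    fun_prop
  · exact M.stronglyMeasurable_bondTensor.comp_measurable (by fun_prop)

theorem exists_norm_stiffness_le : ∃ C, 0 ≤ C ∧ ∀ (u : Vec d → Vec d) a y,
    ‖M.stiffness u a y‖ ≤ C * M.bondWeight (y - a.1) := by
  obtain ⟨C, hC0, hC⟩ := M.exists_deriv2_g_bound
  refine ⟨C * 2, by positivity, fun u a y => ?_⟩
  rw [stiffness, norm_smul, mul_assoc]
  exact mul_le_mul (hC _) (M.norm_bondTensor_le _) (norm_nonneg _) hC0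

theorem integrable_stiffness (hu : Measurable u) (a : Vec d × Vec d) :
    Integrable (M.stiffness u a) M.μ := by
  obtain ⟨C, hC0, hC⟩ := M.exists_norm_stiffness_le
  exact ((M.integrable_bondWeight_sub a.1).const_mul C).mono'
    ((M.stronglyMeasurable_stiffness hu).comp_measurable
      (measurable_const.prodMk measurable_id)).aestronglyMeasurable (ae_of_all _ (hC u a))

theorem exists_integral_norm_stiffness_le : ∃ C, 0 ≤ C ∧ ∀ {u : Vec d → Vec d},
    Measurable u → ∀ a, ∫ y, ‖M.stiffness u a y‖ ∂M.μ ≤ C := by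
  obtain ⟨C, hC0, hC⟩ := M.exists_norm_stiffness_le
  refine ⟨C * M.bondMass, mul_nonneg hC0 M.bondMass_nonneg, fun {u} hu a => ?_⟩
  calc _ ≤ ∫ y, C * M.bondWeight (y - a.1) ∂M.μ :=
        integral_mono (M.integrable_stiffness hu a).norm
          ((M.integrable_bondWeight_sub a.1).const_mul C) (hC u a)
    _ ≤ _ := by
        rw [integral_const_mul]
        exact mul_le_mul_of_nonneg_left (M.integral_bondWeight_sub_le _) hC0

/-- L¹-continuity of the kernel in the decoupled parameter a, the input for compactness. Writing the
kernel as h T, with h the factor g'' and T the bond tensor, use h'T' - hT = h'(T' - T) + (h' - h)T.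
The first term is small by continuity of translation, the second by dominated convergence. -/
theorem tendsto_integral_norm_stiffness_sub (hu : Measurable u) (a : Vec d × Vec d) :
    Tendsto (fun a' => ∫ y, ‖M.stiffness u a' y - M.stiffness u a y‖ ∂M.μ) (𝓝 a) (𝓝 0) := by
  obtain ⟨C, hC0, hC⟩ := M.exists_deriv2_g_bound
  set h : Vec d × Vec d → Vec d → ℝ := fun a y =>
    iteratedDeriv 2 M.g ((√‖y - a.1‖)⁻¹ * ⟪u y - a.2, bondDir y a.1⟫) with hh
  have hhm : ∀ a, Measurable (h a) := by
    intro a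
    refine M.continuous_deriv2_g.measurable.comp ?_
    unfold bondDir
    fun_prop
  have hT : ∀ x : Vec d, Integrable fun y => M.bondTensor (y - x) := fun x =>
    M.integrable_bondTensor.comp_sub_right x
  have h1 : Tendsto (fun a' : Vec d × Vec d =>
      C * ∫ y, ‖M.bondTensor (y - a'.1) - M.bondTensor (y - a.1)‖) (𝓝 a) (𝓝 0) := by
    have := (tendsto_integral_norm_sub_translate M.integrable_bondTensor a.1).comp
      (continuous_fst.tendsto a)
    simpa using this.const_mul C
  have h2 : Tendsto (fun a' : Vec d × Vec d =>
      ∫ y, |h a' y - h a y| * ‖M.bondTensor (y - a.1)‖ ∂M.μ) (𝓝 a) (𝓝 0) := by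
    have hz : ∫ y, (0 : ℝ) ∂M.μ = 0 := integral_zero _ _
    rw [← hz]
    refine tendsto_integral_filter_of_dominated_convergence
      (fun y => 2 * C * ‖M.bondTensor (y - a.1)‖) (Eventually.of_forall fun a' => ?_)
      (Eventually.of_forall fun a' => ae_of_all _ fun y => ?_)
      ((hT a.1).restrict.norm.const_mul _) (ae_of_all _ fun y => ?_)
    · exact ((hhm a').sub (hhm a)).norm.aestronglyMeasurable.mul (hT a.1).restrict.norm.1
    · rw [norm_mul, norm_norm, Real.norm_eq_abs, abs_abs]
      gcongr
      have := abs_sub (h a' y) (h a y)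
      have := hC ((√‖y - a'.1‖)⁻¹ * ⟪u y - a'.2, bondDir y a'.1⟫)
      have := hC ((√‖y - a.1‖)⁻¹ * ⟪u y - a.2, bondDir y a.1⟫)
      simp only [hh] at *
      linarith
    -- The factor h may be discontinuous in a at y = a.1, but there the bond tensor vanishes.
    · by_cases hy : y - a.1 = 0
      · have : M.bondTensor (y - a.1) = 0 := by rw [hy]; simp [bondTensor]
        simp [this]
      · have hcont : ContinuousAt (fun a' => h a' y) a := by
          refine M.continuous_deriv2_g.continuousAt.comp ?_
          have hn : ‖y - a.1‖ ≠ 0 := norm_ne_zero_iff.2 hy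
          have hs : √‖y - a.1‖ ≠ 0 := (Real.sqrt_pos.2 (norm_pos_iff.2 hy)).ne'
          unfold bondDir
          refine ContinuousAt.mul (ContinuousAt.inv₀ (by fun_prop) hs) ?_
          refine ContinuousAt.inner (by fun_prop) ?_
          have c1 : ContinuousAt (fun a' : Vec d × Vec d => ‖y - a'.1‖⁻¹) a :=
            ContinuousAt.inv₀ (by fun_prop) hn
          have c2 : ContinuousAt (fun a' : Vec d × Vec d => y - a'.1) a := by fun_prop
          exact c1.smul c2
        have h3 : ContinuousAt
            (fun a' => |h a' y - h a y| * ‖M.bondTensor (y - a.1)‖) a := by fun_prop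
        simpa using h3.tendsto
  refine squeeze_zero (fun _ => integral_nonneg fun _ => norm_nonneg _) (fun a' => ?_)
    (by simpa using h1.add h2)
  have hi1 : Integrable (fun y => C * ‖M.bondTensor (y - a'.1) - M.bondTensor (y - a.1)‖) :=
    ((hT a'.1).sub (hT a.1)).norm.const_mul C
  have hi2 : Integrable (fun y => |h a' y - h a y| * ‖M.bondTensor (y - a.1)‖) M.μ := by
    refine ((hT a.1).restrict.norm.const_mul (2 * C)).mono'
      (((hhm a').sub (hhm a)).norm.aestronglyMeasurable.mul (hT a.1).restrict.norm.1)
      (ae_of_all _ fun y => ?_)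
    rw [norm_mul, norm_norm, Real.norm_eq_abs, abs_abs]
    gcongr
    have := abs_sub (h a' y) (h a y)
    have := hC ((√‖y - a'.1‖)⁻¹ * ⟪u y - a'.2, bondDir y a'.1⟫)
    have := hC ((√‖y - a.1‖)⁻¹ * ⟪u y - a.2, bondDir y a.1⟫)
    simp only [hh] at *
    linarith
  calc ∫ y, ‖M.stiffness u a' y - M.stiffness u a y‖ ∂M.μ
      ≤ ∫ y, (C * ‖M.bondTensor (y - a'.1) - M.bondTensor (y - a.1)‖ +
          |h a' y - h a y| * ‖M.bondTensor (y - a.1)‖) ∂M.μ := by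
        refine integral_mono
          ((M.integrable_stiffness hu a').sub (M.integrable_stiffness hu a)).norm
          (hi1.restrict.add hi2) fun y => ?_
        have e : M.stiffness u a' y - M.stiffness u a y =
            h a' y • (M.bondTensor (y - a'.1) - M.bondTensor (y - a.1)) +
            (h a' y - h a y) • M.bondTensor (y - a.1) := by
          simp only [stiffness, hh]; module
        change ‖M.stiffness u a' y - M.stiffness u a y‖ ≤ _
        rw [e]
        refine (norm_add_le _ _).trans ?_
        rw [norm_smul, norm_smul, Real.norm_eq_abs, Real.norm_eq_abs]
        gcongr
        exact hC _
    _ = (∫ y, C * ‖M.bondTensor (y - a'.1) - M.bondTensor (y - a.1)‖ ∂M.μ) +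
          ∫ y, |h a' y - h a y| * ‖M.bondTensor (y - a.1)‖ ∂M.μ :=
        integral_add hi1.restrict hi2
    _ ≤ _ := by
        rw [← integral_const_mul]
        refine add_le_add_left ?_ _
        exact setIntegral_le_integral hi1 (ae_of_all _ fun y => by positivity)

end Kernel

end CohesiveBody

theorem measurable_scaledStrain_right {d : ℕ} {u : Vec d → Vec d} (hu : Measurable u)
    (x : Vec d) : Measurable fun y => scaledStrain u (x, y) :=
  (measurable_scaledStrain hu).comp (measurable_const.prodMk measurable_id)

theorem integral_sub_sub {α F : Type*} [MeasurableSpace α] {μ : Measure α}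
    [NormedAddCommGroup F] [NormedSpace ℝ F] {f g h : α → F} (hf : Integrable f μ)
    (hg : Integrable g μ) (hh : Integrable h μ) : ∫ x, (f x - g x - h x) ∂μ =
      (∫ x, f x ∂μ) - (∫ x, g x ∂μ) - ∫ x, h x ∂μ := by
  rw [integral_sub (f := fun x => f x - g x) (hf.sub hg) hh, integral_sub hf hg]

/-! ### Linearisation of the force and ellipticity of its local part -/

namespace CohesiveBody

variable {d : ℕ} (M : CohesiveBody d)

theorem stronglyMeasurable_stiffness_graph {u : Vec d → Vec d} (hu : Measurable u) :
    StronglyMeasurable fun p : Vec d × Vec d => M.stiffness u (p.1, u p.1) p.2 := by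
  have h : Measurable fun p : Vec d × Vec d => ((p.1, u p.1), p.2) :=
    (measurable_fst.prodMk (hu.comp measurable_fst)).prodMk measurable_snd
  have := (M.stronglyMeasurable_stiffness hu).comp_measurable h
  exact this

theorem integrable_bondForce {G : Vec d → ℝ} (hG : Measurable G) (x : Vec d) {C : ℝ}
    (hC : ∀ᵐ y ∂M.μ, M.bondDensity (y - x) * (√‖y - x‖)⁻¹ * |G y| ≤ C * M.bondWeight (y - x)) :
    Integrable (fun y => (2 * (M.bondDensity (y - x) * (√‖y - x‖)⁻¹ * G y)) • bondDir y x)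
      M.μ := by
  have hm1 : Measurable fun y : Vec d => M.bondDensity (y - x) :=
    M.measurable_bondDensity.comp (measurable_id.sub_const x)
  have hm2 : Measurable fun y => 2 * (M.bondDensity (y - x) * (√‖y - x‖)⁻¹ * G y) := by fun_prop
  have hm3 : Measurable fun y : Vec d => bondDir y x := by
    unfold bondDir
    fun_prop
  refine ((M.integrable_bondWeight_sub x).const_mul (2 * C)).mono'
    (hm2.smul hm3).aestronglyMeasurable ?_
  filter_upwards [hC] with y hy
  have h0 := M.bondDensity_nonneg (y - x)
  rw [norm_smul, norm_mul, norm_mul, Real.norm_two, Real.norm_eq_abs (G y),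
    Real.norm_of_nonneg (by positivity : 0 ≤ M.bondDensity (y - x) * (√‖y - x‖)⁻¹)]
  refine (mul_le_of_le_one_right (by positivity) norm_bondDir_le).trans ?_
  linarith

theorem coeFn_L (u : M.Linf) : M.L u =ᵐ[M.μ] M.force u :=
  (M.memLp_force (Lp.stronglyMeasurable u).measurable).coeFn_toLp

theorem isCompact_param (u : M.Linf) :
    IsCompact (closure M.Ω ×ˢ Metric.closedBall (0 : Vec d) ‖u‖) :=
  M.isBounded_Ω.isCompact_closure.prod (isCompact_closedBall _ _)

theorem ae_mem_Ω : ∀ᵐ x ∂M.μ, x ∈ M.Ω := ae_restrict_mem M.isOpen_Ω.measurableSet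

/-- The linearised force operator as a difference of a multiplication operator and a compact
operator. -/
theorem exists_linearization (u : M.Linf) : ∃ A K : M.Linf →L[ℝ] M.Linf, IsCompactOperator K ∧
    (∀ w : M.Linf, A w =ᵐ[M.μ] fun x => (∫ y, M.stiffness u (x, u x) y ∂M.μ) (w x)) ∧
    ∀ w : M.Linf, (A - K) w =ᵐ[M.μ] fun x => -∫ y, (2 * (M.bondDensity (y - x) * (√‖y - x‖)⁻¹ *
      (iteratedDeriv 2 M.g (scaledStrain u (x, y)) * scaledStrain w (x, y)))) •
        bondDir y x ∂M.μ := by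
  have hu := M.measurable_coe u
  obtain ⟨C, hC0, hC⟩ := M.exists_integral_norm_stiffness_le
  have hk : StronglyMeasurable fun p : Vec d × Vec d => M.stiffness u (p.1, u p.1) p.2 :=
    M.stronglyMeasurable_stiffness_graph hu
  have hki : ∀ x, Integrable (fun y => M.stiffness u (x, u x) y) M.μ := fun x =>
    M.integrable_stiffness hu (x, u x)
  obtain ⟨A, hA⟩ := exists_clm_mul (μ := M.μ) (a := fun x => ∫ y, M.stiffness u (x, u x) y ∂M.μ)
    (hk.integral_prod_right' (ν := M.μ)).aestronglyMeasurable hC0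
    (fun x => (norm_integral_le_integral_norm _).trans (hC hu (x, u x)))
  obtain ⟨K, hK⟩ := exists_clm_integral (μ := M.μ) hk hki hC0 (fun x => hC hu (x, u x))
  refine ⟨A, K, ?_, hA, fun w => ?_⟩
  -- The parameter (x, u x) stays a.e. in the closure of Ω times the ball of radius ‖u‖.
  · refine isCompactOperator_integral (M.isCompact_param u) (φ := fun x => (x, u x))
      (Λ := M.stiffness u) (measurable_id.prodMk hu) ?_ (M.integrable_stiffness hu) (hC hu)
      (M.tendsto_integral_norm_stiffness_sub hu) hK
    filter_upwards [M.ae_mem_Ω, Linf_ae_norm_le u] with x hx hux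
    exact ⟨subset_closure hx, by simpa using hux⟩
  · rw [sub_apply]
    filter_upwards [Lp.coeFn_sub (A w) (K w), hA w, hK w] with x h1 h2 h3
    rw [h1, Pi.sub_apply, h2, h3, ContinuousLinearMap.integral_apply (hki x),
      ← integral_sub ((hki x).apply_continuousLinearMap _) (Linf_integrable_clm_apply (hki x) w),
      ← integral_neg]
    refine integral_congr_ae (ae_of_all _ fun y => ?_)
    simp only
    rw [← map_sub, stiffness_apply, scaledStrain_eq (u := w), ← neg_smul, ← neg_sub (w y),
      inner_neg_right, real_inner_comm]
    congr 1
    simp only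
    ring

/-- The force operator is uniformly approximated by its linearisation. -/
theorem exists_norm_L_sub_sub_le (u₀ : M.Linf) {D : M.Linf →L[ℝ] M.Linf}
    (hD : ∀ w : M.Linf, D w =ᵐ[M.μ] fun x => -∫ y, (2 * (M.bondDensity (y - x) *
      (√‖y - x‖)⁻¹ * (iteratedDeriv 2 M.g (scaledStrain u₀ (x, y)) * scaledStrain w (x, y)))) •
        bondDir y x ∂M.μ) :
    ∃ C, 0 ≤ C ∧ ∀ (R : ℝ) (u v : M.Linf), ‖u - u₀‖ ≤ R → ‖v - u₀‖ ≤ R →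
      ‖M.L u - M.L v - D (u - v)‖ ≤ C * R * ‖u - v‖ := by
  obtain ⟨G, hG0, -, hG2⟩ := M.exists_lipschitz_g_derivs
  obtain ⟨G₁, hG₁⟩ := M.g_bounded 1 (by norm_num)
  rw [iteratedDeriv_one] at hG₁
  obtain ⟨G₂, hG₂0, hG₂⟩ := M.exists_deriv2_g_bound
  have hG₁0 : 0 ≤ G₁ := (abs_nonneg _).trans (hG₁ 0)
  have hmass := M.bondMass_nonneg
  refine ⟨8 * G * M.bondMass, by positivity, fun R u v hu hv => ?_⟩
  have hR : 0 ≤ R := (norm_nonneg _).trans hu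
  have hm1 : Measurable (deriv M.g) := measurable_deriv _
  have hm2 : Measurable (iteratedDeriv 2 M.g) := M.continuous_deriv2_g.measurable
  have hif : ∀ (w : M.Linf) x, Integrable (fun y => (2 * (M.bondDensity (y - x) *
      (√‖y - x‖)⁻¹ * deriv M.g (scaledStrain w (x, y)))) • bondDir y x) M.μ := by
    intro w x
    refine M.integrable_bondForce (hm1.comp (measurable_scaledStrain_right (M.measurable_coe w) x))
      x (C := G₁) (ae_of_all _ fun y => ?_)
    have h0 := M.bondDensity_nonneg (y - x)
    have h1 := (M.bondDensity_mul_le (y - x)).1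
    rw [mul_comm G₁]
    exact mul_le_mul h1 (hG₁ _) (abs_nonneg _) (M.bondWeight_nonneg _)
  refine Linf_norm_le (by positivity) ?_
  filter_upwards [Lp.coeFn_sub (M.L u - M.L v) (D (u - v)), Lp.coeFn_sub (M.L u) (M.L v),
    M.coeFn_L u, M.coeFn_L v, hD (u - v), M.ae_scaledStrain_sub u v, M.ae_scaledStrain_sub u u₀,
    M.ae_scaledStrain_sub v u₀, M.ae_abs_scaledStrain_le (u - v),
    M.ae_abs_scaledStrain_le (u - u₀), M.ae_abs_scaledStrain_le (v - u₀)]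
    with x h1 h2 h3 h4 h5 suv suu svu buv buu bvu
  have hid : Integrable (fun y => (2 * (M.bondDensity (y - x) * (√‖y - x‖)⁻¹ *
      (iteratedDeriv 2 M.g (scaledStrain u₀ (x, y)) * scaledStrain ↑(u - v) (x, y)))) •
        bondDir y x) M.μ := by
    refine M.integrable_bondForce
      ((hm2.comp (measurable_scaledStrain_right (M.measurable_coe u₀) x)).mul
        (measurable_scaledStrain_right (M.measurable_coe (u - v)) x)) x
      (C := G₂ * (2 * ‖u - v‖)) ?_
    filter_upwards [buv] with y hy
    have h0 := M.bondDensity_nonneg (y - x)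
    have h1 := (M.bondDensity_mul_le (y - x)).2.1
    rw [Pi.mul_apply, abs_mul]
    calc _ ≤ M.bondDensity (y - x) * (√‖y - x‖)⁻¹ *
          (G₂ * ((√‖y - x‖)⁻¹ * (2 * ‖u - v‖))) := by
          gcongr
          exact hG₂ _
      _ = G₂ * (2 * ‖u - v‖) * (M.bondDensity (y - x) * (√‖y - x‖)⁻¹ ^ 2) := by ring
      _ ≤ _ := by gcongr
  rw [h1, Pi.sub_apply, h2, Pi.sub_apply, h3, h4, h5, M.force_eq, M.force_eq]
  have hneg : ∀ a b c : Vec d, -a - -b - -c = -(a - b - c) := fun a b c => by abel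
  rw [hneg, norm_neg, ← integral_sub_sub (hif u x) (hif v x) hid]
  calc _ ≤ ∫ y, 8 * G * R * ‖u - v‖ * M.bondWeight (y - x) ∂M.μ := by
        refine norm_integral_le_of_norm_le ((M.integrable_bondWeight_sub x).const_mul _) ?_
        filter_upwards [suv, suu, svu, buv, buu, bvu] with y e1 e2 e3 b1 b2 b3
        have h0 := M.bondDensity_nonneg (y - x)
        have hw := (M.bondDensity_mul_le (y - x)).2.2
        set q := (√‖y - x‖)⁻¹
        have hq : 0 ≤ q := by positivity
        set s := scaledStrain u (x, y)
        set t := scaledStrain v (x, y)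
        set s₀ := scaledStrain u₀ (x, y)
        -- Both strains lie within 2Rq of the base strain and differ by at most 2q‖u - v‖. Together
        -- with the factor 2q of the force kernel this yields the constant 8 and the weight q³.
        have key := abs_sub_sub_mul_le M.hasDerivAt_deriv_g hG2 s t s₀ (q * (2 * R))
          (by rw [← e2]; exact b2.trans (by gcongr)) (by rw [← e3]; exact b3.trans (by gcongr))
        rw [← e1] at key
        have hvec : (2 * (M.bondDensity (y - x) * q * deriv M.g s)) • bondDir y x -
            (2 * (M.bondDensity (y - x) * q * deriv M.g t)) • bondDir y x -
            (2 * (M.bondDensity (y - x) * q * (iteratedDeriv 2 M.g s₀ *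
              scaledStrain ↑(u - v) (x, y)))) • bondDir y x =
            (2 * (M.bondDensity (y - x) * q) * (deriv M.g s - deriv M.g t -
              iteratedDeriv 2 M.g s₀ * scaledStrain ↑(u - v) (x, y))) • bondDir y x := by
          module
        rw [hvec, norm_smul, norm_mul,
          Real.norm_of_nonneg (by positivity : 0 ≤ 2 * (M.bondDensity (y - x) * q))]
        calc _ ≤ 2 * (M.bondDensity (y - x) * q) *
              (G * (q * (2 * R)) * (q * (2 * ‖u - v‖))) * 1 := by
              gcongr
              · exact key.trans (by gcongr)
              · exact norm_bondDir_le
          _ = 8 * G * R * ‖u - v‖ * (M.bondDensity (y - x) * q ^ 3) := by ring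
          _ ≤ _ := by gcongr
    _ = 8 * G * R * ‖u - v‖ * ∫ y, M.bondWeight (y - x) ∂M.μ := integral_const_mul _ _
    _ ≤ 8 * G * R * ‖u - v‖ * M.bondMass := by
        gcongr
        exact M.integral_bondWeight_sub_le x
    _ = _ := by ring

/-- The quadratic form of the bonds in a spherical cone is uniformly positive definite. -/
theorem exists_ellipticity (hcone : InteriorConeCondition M.Ω) : ∃ c, 0 < c ∧ ∀ x ∈ M.Ω, ∀ v,
    c * ‖v‖ ^ 2 ≤
      ∫ y, M.bondDensity (y - x) * (√‖y - x‖)⁻¹ ^ 2 * ⟪bondDir y x, v⟫ ^ 2 ∂M.μ := by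
  obtain ⟨θ, l, hθ0, hθ, hl, hcone⟩ := hcone
  have := M.nontrivial_vec
  have hcos0 : 0 < Real.cos θ := Real.cos_pos_of_mem_Ioo ⟨by linarith, hθ⟩
  have hcos1 : Real.cos θ < 1 := by
    rw [← Real.cos_zero]
    exact Real.cos_lt_cos_of_nonneg_of_le_pi_div_two le_rfl hθ.le hθ0
  let f : Vec d → Vec d → ℝ := fun v z =>
    M.bondDensity z * (√‖z‖)⁻¹ ^ 2 * ⟪‖z‖⁻¹ • z, v⟫ ^ 2
  -- A cutoff to the cone with axis e that is continuous in e, unlike the indicator of the cone. The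
  -- form F below is then continuous on a product of two spheres and attains its minimum, which
  -- bounds all axes at once.
  let ψ : Vec d → Vec d → ℝ := fun e z =>
    (Metric.closedBall (0 : Vec d) l).indicator
      (fun z => max 0 (⟪‖z‖⁻¹ • z, e⟫ - Real.cos θ)) z
  have hunit : ∀ z : Vec d, ‖‖z‖⁻¹ • z‖ ≤ 1 := fun z => by
    simpa [bondDir] using norm_bondDir_le (y := z) (x := 0)
  have hf0 : ∀ v z, 0 ≤ f v z := fun v z => by
    have := M.bondDensity_nonneg z
    positivity
  have hfb : ∀ v z, f v z ≤ M.bondWeight z * ‖v‖ ^ 2 := by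
    intro v z
    have h1 : ⟪‖z‖⁻¹ • z, v⟫ ^ 2 ≤ ‖v‖ ^ 2 := by
      rw [← sq_abs]
      gcongr
      exact (abs_real_inner_le_norm _ _).trans
        (mul_le_of_le_one_left (norm_nonneg _) (hunit z))
    exact mul_le_mul (M.bondDensity_mul_le z).2.1 h1 (by positivity) (M.bondWeight_nonneg z)
  have hψ0 : ∀ e z, 0 ≤ ψ e z := fun e z => indicator_nonneg (fun _ _ => le_max_left _ _) z
  have hψ1 : ∀ e, ‖e‖ = 1 → ∀ z, ψ e z ≤ 1 := by
    intro e he z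
    refine indicator_le' (s := Metric.closedBall (0 : Vec d) l) (fun z _ => ?_)
      (fun z _ => zero_le_one) z
    refine max_le zero_le_one ?_
    have h1 := (real_inner_le_norm (‖z‖⁻¹ • z) e).trans
      (mul_le_one₀ (hunit z) (norm_nonneg _) he.le)
    linarith
  have hfm : ∀ v, Measurable (f v) := by
    intro v
    have := M.measurable_bondDensity
    fun_prop
  have hψm : ∀ e, Measurable (ψ e) := fun e =>
    Measurable.indicator (by fun_prop) Metric.isClosed_closedBall.measurableSet
  have hfi : ∀ v, Integrable (f v) := fun v =>
    (M.integrable_bondWeight.mul_const (‖v‖ ^ 2)).mono' (hfm v).aestronglyMeasurable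
      (ae_of_all _ fun z => by rw [Real.norm_of_nonneg (hf0 v z)]; exact hfb v z)
  have hψfle : ∀ e, ‖e‖ = 1 → ∀ v z, ψ e z * f v z ≤ f v z := fun e he v z =>
    mul_le_of_le_one_left (hf0 v z) (hψ1 e he z)
  have hψfi : ∀ e, ‖e‖ = 1 → ∀ v, Integrable fun z => ψ e z * f v z := fun e he v =>
    (hfi v).mono' ((hψm e).mul (hfm v)).aestronglyMeasurable (ae_of_all _ fun z => by
      rw [Real.norm_of_nonneg (mul_nonneg (hψ0 e z) (hf0 v z))]; exact hψfle e he v z)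
  let F : Vec d × Vec d → ℝ := fun p => ∫ z, ψ p.1 z * f p.2 z
  let S : Set (Vec d × Vec d) := Metric.sphere 0 1 ×ˢ Metric.sphere 0 1
  have hS : IsCompact S := (isCompact_sphere _ _).prod (isCompact_sphere _ _)
  have hSne : S.Nonempty :=
    (NormedSpace.sphere_nonempty.2 zero_le_one).prod (NormedSpace.sphere_nonempty.2 zero_le_one)
  have hF : ContinuousOn F S := by
    refine continuousOn_of_dominated (bound := M.bondWeight) (fun p _ =>
      ((hψm _).mul (hfm _)).aestronglyMeasurable) (fun p hp => ae_of_all _ fun z => ?_)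
      M.integrable_bondWeight (ae_of_all _ fun z => ?_)
    · have h1 : ‖p.1‖ = 1 := by simpa using hp.1
      have h2 : ‖p.2‖ = 1 := by simpa using hp.2
      rw [Real.norm_of_nonneg (mul_nonneg (hψ0 _ z) (hf0 _ z))]
      exact (hψfle p.1 h1 p.2 z).trans ((hfb _ _).trans_eq (by rw [h2]; ring))
    · refine Continuous.continuousOn (Continuous.mul ?_ (by fun_prop))
      simp only [ψ, indicator]
      split_ifs <;> fun_prop
  obtain ⟨⟨e₀, v₀⟩, hmem, hmin⟩ := hS.exists_isMinOn hSne hF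
  have he₀ : ‖e₀‖ = 1 := by simpa using hmem.1
  have hv₀ : ‖v₀‖ = 1 := by simpa using hmem.2
  have hnn : ∀ z, 0 ≤ ψ e₀ z * f v₀ z := fun z => mul_nonneg (hψ0 e₀ z) (hf0 v₀ z)
  have hpos : 0 < F (e₀, v₀) := by
    -- If the minimum were 0, v₀ would be orthogonal to every point of a nonempty open piece of the
    -- cone, which forces v₀ = 0.
    refine (integral_nonneg hnn).lt_of_ne' fun h0 => ?_
    have hae := (integral_eq_zero_iff_of_nonneg hnn (hψfi e₀ he₀ v₀)).1 h0
    let U : Set (Vec d) := {z | ‖z‖ < min l M.ε ∧ ‖z‖ * Real.cos θ < ⟪z, e₀⟫}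
    have hU : IsOpen U := by
      refine IsOpen.inter (s := {z : Vec d | ‖z‖ < min l M.ε})
        (t := {z : Vec d | ‖z‖ * Real.cos θ < ⟪z, e₀⟫}) ?_ ?_
      · exact isOpen_lt (by fun_prop) (by fun_prop)
      · exact isOpen_lt (by fun_prop) (by fun_prop)
    have hzero : ∀ᵐ z ∂(volume.restrict U), ⟪z, v₀⟫ = 0 := by
      filter_upwards [ae_restrict_of_ae hae, ae_restrict_mem hU.measurableSet] with z hz hzU
      have hz0 : z ≠ 0 := by
        rintro rfl
        simpa using hzU.2
      have hn : 0 < ‖z‖ := norm_pos_iff.2 hz0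
      have hd := M.bondDensity_pos hz0 (hzU.1.trans_le (min_le_right _ _))
      have hψp : 0 < ψ e₀ z := by
        have hzl : z ∈ Metric.closedBall (0 : Vec d) l := by
          simpa using (hzU.1.trans_le (min_le_left _ _)).le
        simp only [ψ, indicator_of_mem hzl]
        refine lt_max_of_lt_right ?_
        rw [real_inner_smul_left, sub_pos, ← div_eq_inv_mul, lt_div_iff₀ hn, mul_comm]
        exact hzU.2
      have hs := Real.sqrt_pos.2 hn
      have h1 : ψ e₀ z * f v₀ z = 0 := hz
      have h2 : ⟪‖z‖⁻¹ • z, v₀⟫ = 0 := by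
        simpa [f, hψp.ne', hd.ne', hs.ne', hz0] using h1
      rw [real_inner_smul_left] at h2
      simpa [hn.ne'] using h2
    have hall : EqOn (fun z => ⟪z, v₀⟫) (fun _ => (0 : ℝ)) U :=
      Measure.eqOn_open_of_ae_eq hzero hU (by fun_prop) (by fun_prop)
    have hlε : 0 < min l M.ε := lt_min hl M.ε_pos
    set z₀ : Vec d := (min l M.ε / 2) • e₀
    have hz₀ : z₀ ∈ U := by
      have hn : ‖z₀‖ = min l M.ε / 2 := by
        rw [norm_smul, he₀, mul_one, Real.norm_of_nonneg (by positivity)]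
      refine ⟨by rw [hn]; linarith, ?_⟩
      rw [hn, real_inner_smul_left, real_inner_self_eq_norm_sq, he₀, one_pow]
      gcongr
    have hev : ∀ᶠ t : ℝ in 𝓝[≠] 0, z₀ + t • v₀ ∈ U := by
      have : Tendsto (fun t : ℝ => z₀ + t • v₀) (𝓝 0) (𝓝 z₀) := by
        have : Continuous fun t : ℝ => z₀ + t • v₀ := by fun_prop
        simpa using this.tendsto 0
      exact (this.eventually (hU.mem_nhds hz₀)).filter_mono nhdsWithin_le_nhds
    obtain ⟨t, ht, ht0⟩ := (hev.and self_mem_nhdsWithin).exists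
    have ht0 : t ≠ 0 := ht0
    have h1 := hall ht
    have h2 := hall hz₀
    simp only [inner_add_left, real_inner_smul_left, real_inner_self_eq_norm_sq, hv₀] at h1 h2
    rw [h2] at h1
    simp [ht0] at h1
  refine ⟨F (e₀, v₀), hpos, fun x hx v => ?_⟩
  obtain ⟨e, he, hsub⟩ := hcone x hx
  have hint : ∀ v, (∫ y, M.bondDensity (y - x) * (√‖y - x‖)⁻¹ ^ 2 * ⟪bondDir y x, v⟫ ^ 2 ∂M.μ) =
      ∫ y, f v (y - x) ∂M.μ := fun v => rfl
  have hone : ∀ v, ‖v‖ = 1 → F (e₀, v₀) ≤ ∫ y, f v (y - x) ∂M.μ := by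
    intro v hv
    calc F (e₀, v₀) ≤ F (e, v) := hmin ⟨by simpa using he, by simpa using hv⟩
      _ = ∫ y, ψ e (y - x) * f v (y - x) :=
        (integral_sub_right_eq_self (fun z => ψ e z * f v z) x).symm
      _ = ∫ y, ψ e (y - x) * f v (y - x) ∂M.μ := by
        -- The cutoff vanishes off the cone, and the cone at x lies in Ω, so nothing is lost by
        -- restricting to Ω.
        refine (setIntegral_eq_integral_of_forall_compl_eq_zero fun y hy => ?_).symm
        have hy' : y ∉ finiteCone x e l θ := fun h => hy (hsub h)
        suffices ψ e (y - x) = 0 by rw [this, zero_mul]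
        refine indicator_apply_eq_zero.2 fun hyl => max_eq_left ?_
        have hyl : ‖y - x‖ ≤ l := by simpa using hyl
        rw [sub_nonpos, real_inner_smul_left]
        by_contra! hlt
        refine hy' ⟨hyl, ?_⟩
        rcases (norm_nonneg (y - x)).eq_or_lt with h | h
        · rw [← h, inv_zero, zero_mul] at hlt
          exact absurd hlt hcos0.not_gt
        · rw [← div_eq_inv_mul, lt_div_iff₀ h, mul_comm] at hlt
          exact hlt.le
      _ ≤ ∫ y, f v (y - x) ∂M.μ :=
        integral_mono ((hψfi e he v).comp_sub_right x).restrict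
          ((hfi v).comp_sub_right x).restrict fun y => hψfle e he v _
  rw [hint]
  rcases eq_or_ne v 0 with rfl | hv
  · simpa using integral_nonneg fun y => hf0 0 (y - x)
  · have hv' : 0 < ‖v‖ := norm_pos_iff.2 hv
    have h1 := hone (‖v‖⁻¹ • v) (norm_smul_inv_norm hv)
    have h2 : ∀ z, f (‖v‖⁻¹ • v) z = (‖v‖ ^ 2)⁻¹ * f v z := by
      intro z
      simp only [f, real_inner_smul_right]
      ring
    simp only [h2] at h1
    rw [integral_const_mul, ← div_eq_inv_mul, le_div_iff₀ (by positivity)] at h1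
    exact h1

end CohesiveBody

/-- A multiplication operator on `L^∞` by bounded, uniformly elliptic operators is invertible. -/
theorem isUnit_of_ae_elliptic {α F : Type*} [MeasurableSpace α] {μ : Measure α}
    [NormedAddCommGroup F] [InnerProductSpace ℝ F] [CompleteSpace F]
    {A : Lp F ∞ μ →L[ℝ] Lp F ∞ μ} {a : α → F →L[ℝ] F}
    (hA : ∀ w : Lp F ∞ μ, A w =ᵐ[μ] fun x => a x (w x)) {c C : ℝ} (hc : 0 < c)
    (hell : ∀ᵐ x ∂μ, ∀ v, c * ‖v‖ ^ 2 ≤ ⟪a x v, v⟫) (hC : ∀ x, ‖a x‖ ≤ C) : IsUnit A := by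
  -- Enlarging C to be at least c guarantees tc ≤ 1 below.
  set B := max C c
  have hB : 0 < B := hc.trans_le (le_max_right _ _)
  have hcB : c ≤ B := le_max_right _ _
  -- This t minimises 1 - 2tc + t²B², the bound for the squared norm of 1 - t a(x); the minimum is 1
  -- - tc < 1.
  set t := c / B ^ 2
  have ht : 0 < t := by positivity
  have hq : 0 ≤ 1 - t * c := by
    have : t * c ≤ 1 := by
      rw [div_mul_eq_mul_div, div_le_one (by positivity), sq]
      gcongr
    linarith
  refine isUnit_of_norm_sub_smul_le A ht.ne' (Real.sqrt_nonneg (1 - t * c)) ?_ fun w => ?_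
  · rw [Real.sqrt_lt' one_pos]
    nlinarith [mul_pos ht hc]
  · refine Linf_norm_le (by positivity) ?_
    filter_upwards [Lp.coeFn_sub w (t • A w), Lp.coeFn_smul t (A w), hA w, hell,
      Linf_ae_norm_le w] with x h1 h2 h3 h4 h5
    rw [h1, Pi.sub_apply, h2, Pi.smul_apply, h3]
    have hav : ‖a x (w x)‖ ≤ B * ‖w x‖ :=
      ((a x).le_opNorm _).trans (by gcongr; exact (hC x).trans (le_max_left _ _))
    have hsq : ‖w x - t • a x (w x)‖ ^ 2 ≤ (1 - t * c) * ‖w x‖ ^ 2 := by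
      rw [norm_sub_sq_real, norm_smul, real_inner_smul_right, real_inner_comm,
        Real.norm_of_nonneg ht.le]
      have h6 := h4 (w x)
      have h7 : ‖a x (w x)‖ ^ 2 ≤ B ^ 2 * ‖w x‖ ^ 2 := by rw [← mul_pow]; gcongr
      have h8 : t ^ 2 * ‖a x (w x)‖ ^ 2 ≤ t * (c * ‖w x‖ ^ 2) := by
        calc t ^ 2 * ‖a x (w x)‖ ^ 2 ≤ t ^ 2 * (B ^ 2 * ‖w x‖ ^ 2) := by gcongr
          _ = t * (t * B ^ 2) * ‖w x‖ ^ 2 := by ring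
          _ = t * (c * ‖w x‖ ^ 2) := by
            rw [div_mul_cancel₀ c (by positivity : B ^ 2 ≠ 0)]; ring
      nlinarith [mul_le_mul_of_nonneg_left h6 ht.le]
    calc ‖w x - t • a x (w x)‖ ≤ √((1 - t * c) * ‖w x‖ ^ 2) := Real.le_sqrt_of_sq_le hsq
      _ = √(1 - t * c) * ‖w x‖ := by rw [Real.sqrt_mul hq, Real.sqrt_sq (norm_nonneg _)]
      _ ≤ _ := by gcongr

namespace CohesiveBody

variable {d : ℕ} (M : CohesiveBody d)

/-! ### Rigid motions in `L^∞` and the space V -/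

section Rigid

/-- The displacement `x ↦ (B - Bᵀ) x + c`. -/
def rigidMap (b : Matrix (Fin d) (Fin d) ℝ × Vec d) (x : Vec d) : Vec d :=
  Matrix.toEuclideanLin (b.1 - b.1.transpose) x + b.2

theorem rigidMap_mem (b : Matrix (Fin d) (Fin d) ℝ × Vec d) : rigidMap b ∈ rigidMotions d :=
  ⟨b.1 - b.1.transpose, b.2, by simp, rfl⟩

theorem exists_rigidMap_eq {w : Vec d → Vec d} (hw : w ∈ rigidMotions d) :
    ∃ b, rigidMap b = w := by
  obtain ⟨Q, c, hQ, rfl⟩ := hw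
  refine ⟨((1 / 2 : ℝ) • Q, c), funext fun x => ?_⟩
  have : (1 / 2 : ℝ) • Q - ((1 / 2 : ℝ) • Q).transpose = Q := by
    rw [Matrix.transpose_smul, hQ]; module
  rw [rigidMap, this]

theorem memLp_rigidMap (b : Matrix (Fin d) (Fin d) ℝ × Vec d) : MemLp (rigidMap b) ∞ M.μ := by
  have hc : Continuous (rigidMap b) :=
    (LinearMap.continuous_of_finiteDimensional _).add continuous_const
  obtain ⟨C, hC⟩ := (M.isBounded_Ω.isCompact_closure.image hc).isBounded.exists_norm_le
  refine memLp_top_of_bound hc.aestronglyMeasurable C ?_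
  filter_upwards [M.ae_mem_Ω] with x hx
  exact hC _ ⟨x, subset_closure hx, rfl⟩

/-- The rigid motions, as elements of `L^∞`. -/
def rigidLp : Matrix (Fin d) (Fin d) ℝ × Vec d →ₗ[ℝ] M.Linf where
  toFun b := (M.memLp_rigidMap b).toLp
  map_add' b b' := by
    rw [← MemLp.toLp_add]
    refine MemLp.toLp_congr _ _ (ae_of_all _ fun x => ?_)
    have : (b + b').1 - (b + b').1.transpose =
        (b.1 - b.1.transpose) + (b'.1 - b'.1.transpose) := by
      rw [Prod.fst_add, Matrix.transpose_add]; abel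
    simp only [rigidMap, Pi.add_apply, this, map_add, LinearMap.add_apply, Prod.snd_add]
    abel
  map_smul' c b := by
    rw [RingHom.id_apply, ← MemLp.toLp_const_smul]
    refine MemLp.toLp_congr _ _ (ae_of_all _ fun x => ?_)
    have : (c • b).1 - (c • b).1.transpose = c • (b.1 - b.1.transpose) := by
      rw [Prod.smul_fst, Matrix.transpose_smul, smul_sub]
    simp only [rigidMap, Pi.smul_apply, this, map_smul, LinearMap.smul_apply, Prod.smul_snd,
      smul_add]

theorem coeFn_rigidLp (b : Matrix (Fin d) (Fin d) ℝ × Vec d) :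
    M.rigidLp b =ᵐ[M.μ] rigidMap b := (M.memLp_rigidMap b).coeFn_toLp

theorem mem_V_iff (u : M.Linf) : u ∈ M.V ↔ ∀ b, LinfPairing (M.rigidLp b) u = 0 := by
  have key : ∀ b, LinfPairing (M.rigidLp b) u = ∫ x, ⟪u x, rigidMap b x⟫ ∂M.μ := by
    intro b
    rw [LinfPairing_comm, LinfPairing_apply]
    refine integral_congr_ae ?_
    filter_upwards [M.coeFn_rigidLp b] with x hx
    rw [hx]
  constructor
  · intro hu b
    rw [key]
    exact hu _ (rigidMap_mem b)
  · intro h w hw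
    obtain ⟨b, rfl⟩ := exists_rigidMap_eq hw
    rw [← key]
    exact h b

theorem isClosed_V : IsClosed (M.V : Set M.Linf) := by
  have : (M.V : Set M.Linf) = ⋂ b, {u | LinfPairing (M.rigidLp b) u = 0} := by
    ext u
    simp only [SetLike.mem_coe, mem_V_iff, mem_iInter, mem_ofPred_eq]
  rw [this]
  exact isClosed_iInter fun b => isClosed_eq (LinfPairing _).continuous continuous_const

instance : CompleteSpace M.V := M.isClosed_V.completeSpace_coe

theorem ae_scaledStrain_rigidLp (b : Matrix (Fin d) (Fin d) ℝ × Vec d) :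
    ∀ᵐ p ∂(M.μ.prod M.μ), scaledStrain (M.rigidLp b) p = 0 := by
  filter_upwards [Measure.quasiMeasurePreserving_fst.ae (M.coeFn_rigidLp b),
    Measure.quasiMeasurePreserving_snd.ae (M.coeFn_rigidLp b)] with p h1 h2
  rw [scaledStrain_eq, h1, h2, ← scaledStrain_eq]
  exact scaledStrain_rigid (rigidMap_mem b) p

/-- A displacement without strain is a rigid motion. -/
theorem exists_rigidLp_eq {w : M.Linf} (h : ∀ᵐ p ∂(M.μ.prod M.μ), dist p.2 p.1 < M.ε →
    scaledStrain w p = 0) : ∃ b, M.rigidLp b = w := by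
  obtain ⟨r, hr, hw⟩ := ae_eq_rigid_of_ae_inner_eq_zero M.isOpen_Ω M.isConnected_Ω M.ε_pos
    (w := w) (by
      filter_upwards [Measure.ae_ae_of_ae_prod h] with x hx
      filter_upwards [hx] with y hy hlt
      exact inner_eq_zero_of_scaledStrain_eq_zero (p := (x, y)) (hy hlt))
  obtain ⟨b, rfl⟩ := exists_rigidMap_eq hr
  refine ⟨b, Lp.ext ?_⟩
  filter_upwards [M.coeFn_rigidLp b, hw] with x h1 h2
  rw [h1, h2]

/-- Without strain w is a rigid motion, and as an element of V it is orthogonal to itself. -/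
theorem eq_zero_of_mem_V {w : M.Linf} (hw : w ∈ M.V) (h : ∀ᵐ p ∂(M.μ.prod M.μ),
    dist p.2 p.1 < M.ε → scaledStrain w p = 0) : w = 0 := by
  obtain ⟨b, rfl⟩ := M.exists_rigidLp_eq h
  exact eq_zero_of_LinfPairing_self ((M.mem_V_iff _).1 hw b)

/-- The `i`-th element of a finite spanning family of the rigid motions. -/
def rigidBasis (i : Fin (Module.finrank ℝ (Matrix (Fin d) (Fin d) ℝ × Vec d))) : M.Linf :=
  M.rigidLp (Module.finBasis ℝ _ i)

theorem mem_V_iff_rigidBasis (u : M.Linf) :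
    u ∈ M.V ↔ ∀ i, LinfPairing (M.rigidBasis i) u = 0 := by
  rw [mem_V_iff]
  refine ⟨fun h i => h _, fun h b => ?_⟩
  rw [← (Module.finBasis ℝ (Matrix (Fin d) (Fin d) ℝ × Vec d)).sum_repr b, map_sum,
    LinfPairing_comm, map_sum]
  refine Finset.sum_eq_zero fun i _ => ?_
  have := h i
  rw [LinfPairing_comm] at this
  rw [map_smul, map_smul, smul_eq_mul]
  exact mul_eq_zero_of_right _ this

/-- A finite rank operator onto the rigid motions whose kernel is `V`. -/
def rigidProj : M.Linf →L[ℝ] M.Linf :=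
  ∑ i, (LinfPairing (M.rigidBasis i)).smulRight (M.rigidBasis i)

theorem rigidProj_apply (w : M.Linf) :
    M.rigidProj w = ∑ i, LinfPairing (M.rigidBasis i) w • M.rigidBasis i := by
  simp [rigidProj, sum_apply]

theorem rigidProj_eq_rigidLp (w : M.Linf) : ∃ b, M.rigidProj w = M.rigidLp b :=
  ⟨∑ i, LinfPairing (M.rigidBasis i) w • Module.finBasis ℝ _ i, by
    rw [rigidProj_apply, map_sum]; simp only [map_smul]; rfl⟩

theorem isCompactOperator_rigidProj : IsCompactOperator M.rigidProj := by
  unfold rigidProj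
  refine Finset.sum_induction _ (fun T : M.Linf →L[ℝ] M.Linf => IsCompactOperator T)
    (fun _ _ h h' => h.add h') isCompactOperator_zero fun i _ => ?_
  exact (isCompactOperator_of_locallyCompactSpace_rng
    (ContinuousLinearMap.toSpanSingleton ℝ (M.rigidBasis i))).comp_clm
      (LinfPairing (M.rigidBasis i))

theorem LinfPairing_rigidProj (w : M.Linf) :
    LinfPairing w (M.rigidProj w) = ∑ i, LinfPairing (M.rigidBasis i) w ^ 2 := by
  rw [rigidProj_apply, map_sum]
  refine Finset.sum_congr rfl fun i _ => ?_
  rw [map_smul, smul_eq_mul, LinfPairing_comm w, sq]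

/-- The quadratic form of `rigidProj` is the sum of the squared pairings with a spanning family, so
if it is not positive all of them vanish. -/
theorem mem_V_of_LinfPairing_rigidProj_le {w : M.Linf}
    (h : LinfPairing w (M.rigidProj w) ≤ 0) : w ∈ M.V := by
  rw [LinfPairing_rigidProj] at h
  rw [mem_V_iff_rigidBasis]
  intro i
  have h1 := (Finset.sum_eq_zero_iff_of_nonneg fun i _ => sq_nonneg _).1
    (h.antisymm (Finset.sum_nonneg fun i _ => sq_nonneg _)) i (Finset.mem_univ i)
  exact pow_eq_zero_iff two_ne_zero |>.1 h1

theorem rigidProj_eq_zero {w : M.Linf} (h : w ∈ M.V) : M.rigidProj w = 0 := by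
  rw [rigidProj_apply]
  refine Finset.sum_eq_zero fun i _ => ?_
  rw [(M.mem_V_iff_rigidBasis w).1 h i, zero_smul]

end Rigid

/-! ### Weak form of the force -/

section WeakForm

theorem LinfPairing_bondForce {f : M.Linf} {G : Vec d × Vec d → ℝ} (hm : Measurable G)
    (symm : ∀ p, G p.swap = G p) {C : ℝ}
    (hC : ∀ᵐ p ∂(M.μ.prod M.μ), M.bondDensity (p.2 - p.1) * (√‖p.2 - p.1‖)⁻¹ * |G p| ≤
      C * M.bondWeight (p.2 - p.1))
    (hf : f =ᵐ[M.μ] fun x => -∫ y, (2 * (M.bondDensity (y - x) * (√‖y - x‖)⁻¹ * G (x, y))) •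
      bondDir y x ∂M.μ) (φ : M.Linf) :
    Integrable (fun p : Vec d × Vec d => M.bondDensity (p.2 - p.1) * G p * scaledStrain φ p)
      (M.μ.prod M.μ) ∧
    LinfPairing f φ =
      ∫ p, M.bondDensity (p.2 - p.1) * G p * scaledStrain φ p ∂(M.μ.prod M.μ) := by
  have hmd := M.measurable_bondDensity_prod
  have hint : Integrable (fun p : Vec d × Vec d =>
      M.bondDensity (p.2 - p.1) * (√‖p.2 - p.1‖)⁻¹ * G p) (M.μ.prod M.μ) := by
    refine (M.integrable_bondWeight_prod.const_mul C).mono'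
      (by fun_prop : Measurable _).aestronglyMeasurable ?_
    filter_upwards [hC] with p hp
    have := M.bondDensity_nonneg (p.2 - p.1)
    rwa [norm_mul, Real.norm_of_nonneg (by positivity)]
  obtain ⟨h1, h2⟩ := M.integral_inner_bondForce symm hint (Lp.aestronglyMeasurable φ)
    (Linf_ae_norm_le φ)
  refine ⟨h1, ?_⟩
  rw [← h2, LinfPairing_apply]
  refine integral_congr_ae ?_
  filter_upwards [hf] with x hx
  rw [hx]

theorem LinfPairing_L (u φ : M.Linf) :
    Integrable (fun p : Vec d × Vec d => M.bondDensity (p.2 - p.1) *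
      deriv M.g (scaledStrain u p) * scaledStrain φ p) (M.μ.prod M.μ) ∧
    LinfPairing (M.L u) φ = ∫ p, M.bondDensity (p.2 - p.1) * deriv M.g (scaledStrain u p) *
      scaledStrain φ p ∂(M.μ.prod M.μ) := by
  obtain ⟨C, hC⟩ := M.g_bounded 1 (by norm_num)
  rw [iteratedDeriv_one] at hC
  refine M.LinfPairing_bondForce (G := fun p => deriv M.g (scaledStrain u p))
    ((measurable_deriv _).comp (measurable_scaledStrain (M.measurable_coe u)))
    (fun p => by rw [scaledStrain_swap]) (C := C) (ae_of_all _ fun p => ?_)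
    ((M.coeFn_L u).trans (ae_of_all _ fun x => M.force_eq _ x)) φ
  rw [mul_comm C]
  exact mul_le_mul (M.bondDensity_mul_le _).1 (hC _) (abs_nonneg _) (M.bondWeight_nonneg _)

/-- Balance of force and torque: a rigid test displacement has no strain, so the weak form vanishes
on it. -/
theorem L_mem_V (u : M.Linf) : M.L u ∈ M.V := by
  rw [mem_V_iff]
  intro b
  rw [LinfPairing_comm, (M.LinfPairing_L u _).2]
  refine integral_eq_zero_of_ae ?_
  filter_upwards [M.ae_scaledStrain_rigidLp b] with p hp
  rw [hp, mul_zero, Pi.zero_apply]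

end WeakForm

/-! ### The linearised force as an isomorphism of V -/

section Linearization

variable {u₀ : M.Linf} {D : M.Linf →L[ℝ] M.Linf}

theorem LinfPairing_linearization
    (hD : ∀ w : M.Linf, D w =ᵐ[M.μ] fun x => -∫ y, (2 * (M.bondDensity (y - x) *
      (√‖y - x‖)⁻¹ * (iteratedDeriv 2 M.g (scaledStrain u₀ (x, y)) * scaledStrain w (x, y)))) •
        bondDir y x ∂M.μ) (w φ : M.Linf) :
    Integrable (fun p : Vec d × Vec d => M.bondDensity (p.2 - p.1) *
      (iteratedDeriv 2 M.g (scaledStrain u₀ p) * scaledStrain w p) * scaledStrain φ p)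
      (M.μ.prod M.μ) ∧
    LinfPairing (D w) φ = ∫ p, M.bondDensity (p.2 - p.1) *
      (iteratedDeriv 2 M.g (scaledStrain u₀ p) * scaledStrain w p) *
        scaledStrain φ p ∂(M.μ.prod M.μ) := by
  obtain ⟨C, hC0, hC⟩ := M.exists_deriv2_g_bound
  have hm1 : Measurable fun p => iteratedDeriv 2 M.g (scaledStrain u₀ p) :=
    M.continuous_deriv2_g.measurable.comp (measurable_scaledStrain (M.measurable_coe u₀))
  have hm2 : Measurable fun p => scaledStrain w p := measurable_scaledStrain (M.measurable_coe w)
  refine M.LinfPairing_bondForce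
    (G := fun p => iteratedDeriv 2 M.g (scaledStrain u₀ p) * scaledStrain w p)
    (hm1.mul hm2) (fun p => by rw [scaledStrain_swap, scaledStrain_swap])
    (C := C * (2 * ‖w‖)) ?_ (hD w) φ
  filter_upwards [M.ae_abs_scaledStrain_le_prod w] with p hp
  have h0 := M.bondDensity_nonneg (p.2 - p.1)
  have h1 := (M.bondDensity_mul_le (p.2 - p.1)).2.1
  rw [abs_mul]
  calc _ ≤ M.bondDensity (p.2 - p.1) * (√‖p.2 - p.1‖)⁻¹ *
        (C * ((√‖p.2 - p.1‖)⁻¹ * (2 * ‖w‖))) := by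
        gcongr
        exact hC _
    _ = C * (2 * ‖w‖) * (M.bondDensity (p.2 - p.1) * (√‖p.2 - p.1‖)⁻¹ ^ 2) := by ring
    _ ≤ _ := by gcongr

variable {M}

/-- The strains fill at most a compact interval inside (re, rc), on which the continuous positive
g'' has a positive minimum. -/
theorem StrictlyInsideStrengthDomain.exists_deriv2_ge (h : M.StrictlyInsideStrengthDomain u₀) :
    ∃ m, 0 < m ∧ ∀ᵐ p ∂(M.μ.prod M.μ), dist p.2 p.1 < M.ε →
      m ≤ iteratedDeriv 2 M.g (scaledStrain u₀ p) := by
  obtain ⟨r₁, r₂, h1, h2, h⟩ := h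
  rcases (Icc r₁ r₂).eq_empty_or_nonempty with he | hne
  -- For an empty interval almost no pair lies within the horizon, so any positive bound serves.
  · refine ⟨1, one_pos, h.mono fun p hp hlt => ?_⟩
    have := hp hlt
    rw [he] at this
    exact this.elim
  · obtain ⟨r, hr, hmin⟩ := isCompact_Icc.exists_isMinOn hne M.continuous_deriv2_g.continuousOn
    exact ⟨_, M.g_deriv2_pos r (h1.trans_le hr.1) (hr.2.trans_lt h2),
      h.mono fun p hp hlt => hmin (hp hlt)⟩

/-- The linearised force at a point strictly inside the strength domain is an isomorphism of
`V`. -/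
theorem StrictlyInsideStrengthDomain.exists_equiv (hcone : InteriorConeCondition M.Ω)
    (h : M.StrictlyInsideStrengthDomain u₀) {A K : M.Linf →L[ℝ] M.Linf}
    (hK : IsCompactOperator K)
    (hA : ∀ w : M.Linf, A w =ᵐ[M.μ] fun x => (∫ y, M.stiffness u₀ (x, u₀ x) y ∂M.μ) (w x))
    (hD : ∀ w : M.Linf, (A - K) w =ᵐ[M.μ] fun x => -∫ y, (2 * (M.bondDensity (y - x) *
      (√‖y - x‖)⁻¹ * (iteratedDeriv 2 M.g (scaledStrain u₀ (x, y)) * scaledStrain w (x, y)))) •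
        bondDir y x ∂M.μ) :
    ∃ B : M.V ≃L[ℝ] M.V, ∀ w : M.V, ((B w : M.V) : M.Linf) = (A - K) w := by
  obtain ⟨m, hm, hge⟩ := h.exists_deriv2_ge
  have hu₀ := M.measurable_coe u₀
  have hAunit : IsUnit A := by
    obtain ⟨c, hc, hell⟩ := M.exists_ellipticity hcone
    obtain ⟨C, hC0, hC⟩ := M.exists_integral_norm_stiffness_le
    refine isUnit_of_ae_elliptic hA (c := 2 * m * c) (by positivity) ?_
      fun x => (norm_integral_le_integral_norm _).trans (hC hu₀ (x, u₀ x))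
    filter_upwards [M.ae_mem_Ω, Measure.ae_ae_of_ae_prod hge] with x hx hgex v
    have hki := M.integrable_stiffness hu₀ (x, u₀ x)
    have hkv := hki.apply_continuousLinearMap v
    rw [ContinuousLinearMap.integral_apply hki, real_inner_comm, ← integral_inner hkv]
    have hform : ∀ y, ⟪v, M.stiffness u₀ (x, u₀ x) y v⟫ =
        2 * (iteratedDeriv 2 M.g (scaledStrain u₀ (x, y)) *
          (M.bondDensity (y - x) * (√‖y - x‖)⁻¹ ^ 2 * ⟪bondDir y x, v⟫ ^ 2)) := by
      intro y
      rw [stiffness_apply, real_inner_smul_right, real_inner_comm]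
      ring
    calc 2 * m * c * ‖v‖ ^ 2 = 2 * m * (c * ‖v‖ ^ 2) := by ring
      _ ≤ 2 * m * ∫ y, M.bondDensity (y - x) * (√‖y - x‖)⁻¹ ^ 2 * ⟪bondDir y x, v⟫ ^ 2 ∂M.μ := by
          gcongr
          exact hell x hx v
      _ = ∫ y, 2 * m * (M.bondDensity (y - x) * (√‖y - x‖)⁻¹ ^ 2 * ⟪bondDir y x, v⟫ ^ 2) ∂M.μ :=
          (integral_const_mul _ _).symm
      _ ≤ _ := by
          refine integral_mono_of_nonneg (ae_of_all _ fun y => ?_) (hkv.const_inner v) ?_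
          · have := M.bondDensity_nonneg (y - x)
            simp only [Pi.zero_apply]
            positivity
          · filter_upwards [hgex] with y hy
            rw [hform, mul_assoc]
            have h0 := M.bondDensity_nonneg (y - x)
            rcases lt_or_ge ‖y - x‖ M.ε with hlt | hle
            · have := hy (by rwa [dist_eq_norm])
              gcongr
            · rw [M.bondDensity_of_le hle]
              simp
  have hnn : ∀ w : M.Linf, ∀ᵐ p ∂(M.μ.prod M.μ), 0 ≤ M.bondDensity (p.2 - p.1) *
      (iteratedDeriv 2 M.g (scaledStrain u₀ p) * scaledStrain w p) * scaledStrain w p := by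
    intro w
    filter_upwards [hge] with p hp
    have h0 := M.bondDensity_nonneg (p.2 - p.1)
    rw [mul_assoc, mul_assoc]
    rcases lt_or_ge ‖p.2 - p.1‖ M.ε with hlt | hle
    · have := hm.le.trans (hp (by rwa [dist_eq_norm]))
      exact mul_nonneg h0 (mul_nonneg this (mul_self_nonneg _))
    · rw [M.bondDensity_of_le hle, zero_mul]
  -- The quadratic form is an integral of nonnegative terms g'' times squared strain. If it is not
  -- positive, the strain of w vanishes within the horizon.
  have hker : ∀ w : M.Linf, w ∈ M.V → LinfPairing ((A - K) w) w ≤ 0 → w = 0 := by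
    intro w hw hle
    obtain ⟨hi, he⟩ := M.LinfPairing_linearization hD w w
    rw [he] at hle
    have h0 := (integral_eq_zero_iff_of_nonneg_ae (hnn w) hi).1
      (hle.antisymm (integral_nonneg_of_ae (hnn w)))
    refine M.eq_zero_of_mem_V hw ?_
    filter_upwards [h0, hge] with p hp hgp hlt
    have h2 := hm.trans_le (hgp hlt)
    by_cases hz : p.2 - p.1 = 0
    · rw [scaledStrain, hz]
      simp
    · have h3 := M.bondDensity_pos hz (by rwa [← dist_eq_norm])
      simpa [h2.ne', h3.ne'] using hp
  have hpos : ∀ w : M.Linf, 0 ≤ LinfPairing ((A - K) w) w := fun w => by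
    rw [(M.LinfPairing_linearization hD w w).2]
    exact integral_nonneg_of_ae (hnn w)
  have hmaps : ∀ w : M.Linf, (A - K) w ∈ M.V := by
    intro w
    rw [mem_V_iff]
    intro b
    rw [LinfPairing_comm, (M.LinfPairing_linearization hD w _).2]
    refine integral_eq_zero_of_ae ?_
    filter_upwards [M.ae_scaledStrain_rigidLp b] with p hp
    rw [hp, mul_zero, Pi.zero_apply]
  -- A and K need not preserve V separately, so the Fredholm alternative is applied on all of `L^∞`.
  -- Adding the finite rank `rigidProj` removes the kernel: if (A - K)w = -Pw, the nonnegative form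
  -- of A - K equals minus a sum of squares, so w ∈ V, Pw = 0 and finally w = 0.
  have hbij : Function.Bijective (A - (K - M.rigidProj)) := by
    refine bijective_sub_of_isCompactOperator hAunit (hK.sub M.isCompactOperator_rigidProj)
      fun w hw => ?_
    have h1 : (A - K) w = -M.rigidProj w := by
      rw [sub_apply, hw, sub_apply]; abel
    have h2 := hpos w
    rw [h1, LinfPairing_comm, map_neg] at h2
    have hV := M.mem_V_of_LinfPairing_rigidProj_le (by linarith)
    refine hker w hV ?_
    rw [h1, M.rigidProj_eq_zero hV, neg_zero, LinfPairing_comm, map_zero]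
  let T : M.V →L[ℝ] M.V := ((A - K).comp M.V.subtypeL).codRestrict M.V fun w => hmaps w
  have hT : ∀ w : M.V, ((T w : M.V) : M.Linf) = (A - K) w := fun w => rfl
  have hinj : Function.Injective T := by
    refine (injective_iff_map_eq_zero T).2 fun w hw => Subtype.ext (hker w w.2 ?_)
    rw [← hT, hw, ZeroMemClass.coe_zero, LinfPairing_comm, map_zero]
  have hsurj : Function.Surjective T := by
    intro f
    obtain ⟨w, hw⟩ := hbij.2 f
    have h1 : (A - K) w + M.rigidProj w = f := by
      rw [← hw]
      simp only [sub_apply]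
      abel
    -- Both f and (A - K)w lie in V, hence so does Pw. Being also rigid, Pw is 0, so w itself lies
    -- in V and solves the original equation.
    have hPV : M.rigidProj w ∈ M.V := by
      rw [← eq_sub_iff_add_eq'] at h1
      rw [h1]
      exact M.V.sub_mem f.2 (hmaps w)
    have hP : M.rigidProj w = 0 := by
      obtain ⟨b, hb⟩ := M.rigidProj_eq_rigidLp w
      have := (M.mem_V_iff _).1 hPV b
      rw [← hb] at this
      exact eq_zero_of_LinfPairing_self this
    have hwV : w ∈ M.V := M.mem_V_of_LinfPairing_rigidProj_le (by rw [hP, map_zero])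
    refine ⟨⟨w, hwV⟩, Subtype.ext ?_⟩
    rw [hT]
    rw [hP, add_zero] at h1
    exact h1
  exact ⟨ContinuousLinearEquiv.ofBijective T (LinearMap.ker_eq_bot.2 hinj)
    (LinearMap.range_eq_top.2 hsurj), fun w => rfl⟩

end Linearization

end CohesiveBody

theorem hasFDerivAt_of_norm_sub_le_sq {X Y : Type*} [NormedAddCommGroup X] [NormedSpace ℝ X]
    [NormedAddCommGroup Y] [NormedSpace ℝ Y] {f : X → Y} {f' : X →L[ℝ] Y} {x₀ : X} {C : ℝ}
    (h : ∀ x, ‖f x - f x₀ - f' (x - x₀)‖ ≤ C * ‖x - x₀‖ ^ 2) : HasFDerivAt f f' x₀ := by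
  refine HasFDerivAt.of_isLittleO
    (Asymptotics.IsBigO.trans_isLittleO (g := fun x => ‖x - x₀‖ ^ 2) ?_
      (Asymptotics.isLittleO_pow_sub_sub x₀ one_lt_two))
  exact Asymptotics.IsBigO.of_bound C (Eventually.of_forall fun x => by simpa using h x)

/-! ### The energy: derivative, critical points and convexity -/

namespace CohesiveBody

variable {d : ℕ} (M : CohesiveBody d)

theorem E_eq (b u : M.Linf) : M.E b u = M.PD u - LinfPairing u b := rfl

/-- The second-order remainder of the energy, as an integral over bonds. -/
theorem E_sub_E_sub (b u v : M.Linf) :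
    Integrable (fun p : Vec d × Vec d => M.bondDensity (p.2 - p.1) * (M.g (scaledStrain v p) -
      M.g (scaledStrain u p) - deriv M.g (scaledStrain u p) * scaledStrain ↑(v - u) p))
      (M.μ.prod M.μ) ∧
    M.E b v - M.E b u - LinfPairing (M.L u - b) (v - u) =
      ∫ p, M.bondDensity (p.2 - p.1) * (M.g (scaledStrain v p) - M.g (scaledStrain u p) -
        deriv M.g (scaledStrain u p) * scaledStrain ↑(v - u) p) ∂(M.μ.prod M.μ) := by
  have hv := M.integrable_energy (M.measurable_coe v)
  have hu := M.integrable_energy (M.measurable_coe u)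
  obtain ⟨hL, hLe⟩ := M.LinfPairing_L u (v - u)
  have e : (fun p : Vec d × Vec d => M.bondDensity (p.2 - p.1) * (M.g (scaledStrain v p) -
      M.g (scaledStrain u p) - deriv M.g (scaledStrain u p) * scaledStrain ↑(v - u) p)) =
      fun p => M.bondDensity (p.2 - p.1) * M.g (scaledStrain v p) -
        M.bondDensity (p.2 - p.1) * M.g (scaledStrain u p) -
        M.bondDensity (p.2 - p.1) * deriv M.g (scaledStrain u p) * scaledStrain ↑(v - u) p := by
    funext p
    ring
  have hlin : LinfPairing (M.L u - b) (v - u) =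
      LinfPairing (M.L u) (v - u) - (LinfPairing v b - LinfPairing u b) := by
    rw [LinfPairing_comm, map_sub, LinfPairing_comm _ (M.L u), LinfPairing_comm _ b,
      map_sub (LinfPairing b), LinfPairing_comm b v, LinfPairing_comm b u]
  rw [e]
  refine ⟨(hv.sub hu).sub hL, ?_⟩
  rw [integral_sub_sub hv hu hL, ← PD_eq, ← PD_eq, ← hLe, hlin, E_eq, E_eq]
  ring

/-- The remainder is quadratic because g' is Lipschitz: the two strain factors contribute
|y-x|^(-1), which the bond weight dominates. -/
theorem hasFDerivAt_E (b u : M.Linf) : HasFDerivAt (M.E b) (LinfPairing (M.L u - b)) u := by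
  obtain ⟨C, hC0, hC, -⟩ := M.exists_lipschitz_g_derivs
  refine hasFDerivAt_of_norm_sub_le_sq
    (C := C * 4 * ∫ p : Vec d × Vec d, M.bondWeight (p.2 - p.1) ∂(M.μ.prod M.μ)) fun v => ?_
  rw [(M.E_sub_E_sub b u v).2]
  calc _ ≤ ∫ p : Vec d × Vec d, C * 4 * ‖v - u‖ ^ 2 * M.bondWeight (p.2 - p.1)
        ∂(M.μ.prod M.μ) := by
        refine norm_integral_le_of_norm_le (M.integrable_bondWeight_prod.const_mul _) ?_
        filter_upwards [M.ae_scaledStrain_sub_prod v u, M.ae_abs_scaledStrain_le_prod (v - u)]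
          with p h1 h2
        have h0 := M.bondDensity_nonneg (p.2 - p.1)
        have h3 := (M.bondDensity_mul_le (p.2 - p.1)).2.1
        have key := abs_sub_sub_mul_le M.hasDerivAt_g hC (scaledStrain v p) (scaledStrain u p)
          (scaledStrain u p) _ le_rfl (by simp)
        rw [← h1] at key
        rw [norm_mul, Real.norm_of_nonneg h0, Real.norm_eq_abs]
        calc _ ≤ M.bondDensity (p.2 - p.1) * (C * ((√‖p.2 - p.1‖)⁻¹ * (2 * ‖v - u‖)) *
              ((√‖p.2 - p.1‖)⁻¹ * (2 * ‖v - u‖))) := by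
              gcongr
              exact key.trans (by gcongr)
          _ = C * 4 * ‖v - u‖ ^ 2 *
              (M.bondDensity (p.2 - p.1) * (√‖p.2 - p.1‖)⁻¹ ^ 2) := by ring
          _ ≤ _ := by gcongr
    _ = _ := by
        rw [integral_const_mul]
        ring

-- Derivatives are unique, and the pairing is nondegenerate: pairing L[u] - b with itself forces it
-- to vanish.
variable {M} in
theorem IsCriticalPoint.L_eq {b u : M.Linf} (h : M.IsCriticalPoint b u) : M.L u = b := by
  have h1 : LinfPairing (M.L u - b) = 0 := (M.hasFDerivAt_E b u).unique h
  exact sub_eq_zero.1 (eq_zero_of_LinfPairing_self (by rw [h1]; rfl))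

theorem strictConvexOn_g : StrictConvexOn ℝ (Icc M.re M.rc) M.g := by
  have hg : Continuous M.g :=
    continuous_iff_continuousAt.2 fun r => (M.hasDerivAt_g r).continuousAt
  refine strictConvexOn_of_deriv2_pos (convex_Icc _ _) hg.continuousOn fun r hr => ?_
  rw [interior_Icc] at hr
  rw [← iteratedDeriv_eq_iterate]
  exact M.g_deriv2_pos r hr.1 hr.2

theorem g_tangent_lt {s t : ℝ} (hs : s ∈ Ioo M.re M.rc) (ht : t ∈ Ioo M.re M.rc) (hne : s ≠ t) :
    0 < M.g t - M.g s - deriv M.g s * (t - s) := by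
  have := M.strictConvexOn_g.add_mul_sub_lt (Ioo_subset_Icc_self hs) (Ioo_subset_Icc_self ht)
    hne (M.hasDerivAt_g s)
  linarith

/-- Within the horizon both strains lie where g is convex, so its tangent gap is nonnegative; beyond
it the density is 0. -/
theorem ae_remainder_nonneg {u v : M.Linf} (hu : u ∈ M.strengthDomain)
    (hv : v ∈ M.strengthDomain) : ∀ᵐ p ∂(M.μ.prod M.μ),
      0 ≤ M.bondDensity (p.2 - p.1) * (M.g (scaledStrain v p) - M.g (scaledStrain u p) -
        deriv M.g (scaledStrain u p) * scaledStrain ↑(v - u) p) := by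
  filter_upwards [hu, hv, M.ae_scaledStrain_sub_prod v u] with p hup hvp h1
  have h0 := M.bondDensity_nonneg (p.2 - p.1)
  rcases lt_or_ge ‖p.2 - p.1‖ M.ε with hlt | hle
  · rw [h1]
    refine mul_nonneg h0 ?_
    have hlt' : dist p.2 p.1 < M.ε := by rwa [dist_eq_norm]
    rcases eq_or_ne (scaledStrain u p) (scaledStrain v p) with h | h
    · rw [h]; simp
    · exact (M.g_tangent_lt (hup hlt') (hvp hlt') h).le
  · rw [M.bondDensity_of_le hle, zero_mul]

/-- Critical points in the strength domain minimise the energy there. -/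
theorem E_le_E_of_L_eq {b u v : M.Linf} (hu : u ∈ M.strengthDomain) (hv : v ∈ M.strengthDomain)
    (hL : M.L u = b) : M.E b u ≤ M.E b v := by
  have h := (M.E_sub_E_sub b u v).2
  rw [hL, sub_self, LinfPairing_comm, map_zero, sub_zero] at h
  have := integral_nonneg_of_ae (M.ae_remainder_nonneg hu hv)
  linarith

/-- Equal energies make the integral of the nonnegative gaps zero, so almost every gap vanishes. By
strict convexity, and positivity of the density off the diagonal, the strains agree. -/
theorem ae_scaledStrain_sub_eq_zero {b u v : M.Linf} (hu : u ∈ M.strengthDomain)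
    (hv : v ∈ M.strengthDomain) (hL : M.L u = b) (hE : M.E b v = M.E b u) :
    ∀ᵐ p ∂(M.μ.prod M.μ), dist p.2 p.1 < M.ε → scaledStrain ↑(v - u) p = 0 := by
  obtain ⟨hi, h⟩ := M.E_sub_E_sub b u v
  rw [hL, sub_self, LinfPairing_comm, map_zero, sub_zero, hE, sub_self] at h
  have h0 := (integral_eq_zero_iff_of_nonneg_ae (M.ae_remainder_nonneg hu hv) hi).1 h.symm
  filter_upwards [h0, hu, hv, M.ae_scaledStrain_sub_prod v u] with p hp hup hvp h1 hlt
  by_cases hz : p.2 - p.1 = 0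
  · rw [scaledStrain, hz]
    simp
  · have h3 := M.bondDensity_pos hz (by rwa [← dist_eq_norm])
    rw [h1, sub_eq_zero]
    by_contra hne
    have h4 := M.g_tangent_lt (s := scaledStrain u p) (t := scaledStrain v p) (hup hlt) (hvp hlt)
      (Ne.symm hne)
    rw [← h1] at h4
    exact (mul_pos h3 h4).ne' hp

variable {M} in
theorem StrictlyInsideStrengthDomain.mem_strengthDomain {u : M.Linf}
    (h : M.StrictlyInsideStrengthDomain u) : u ∈ M.strengthDomain := by
  obtain ⟨r₁, r₂, h1, h2, h⟩ := h
  exact h.mono fun p hp hlt => ⟨h1.trans_le (hp hlt).1, (hp hlt).2.trans_lt h2⟩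

end CohesiveBody

/-! ### The main theorem -/

theorem theorem3p7 {d : ℕ} (M : CohesiveBody d) (hcone : InteriorConeCondition M.Ω)
    (u₀ b₀ : M.V)
    (hu₀ : M.StrictlyInsideStrengthDomain u₀)
    (hcrit : M.IsCriticalPoint b₀ u₀) :
    ∃ (D : M.Linf →L[ℝ] M.Linf) (A : M.V ≃L[ℝ] M.V),
      HasFDerivAt M.L D u₀ ∧
      (∀ w : M.V, ((A w : M.V) : M.Linf) = D w) ∧
      ∃ R₀ : ℝ, 0 < R₀ ∧ ∀ R : ℝ, 0 < R → R ≤ R₀ →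
        (∀ T : ℝ, 0 ≤ T → ∀ b : C(Set.Icc (0 : ℝ) T, M.V),
          (∀ t, ‖b t - b₀‖ ≤ R / (2 * ‖(A.symm : M.V →L[ℝ] M.V)‖)) →
          ∃! u : C(Set.Icc (0 : ℝ) T, M.V),
            (∀ t, ‖u t - u₀‖ ≤ R) ∧ ∀ t, M.L (u t : M.Linf) = (b t : M.Linf)) ∧
        (∀ u : M.V, (u : M.Linf) ∈ M.strengthDomain → ‖u - u₀‖ ≤ R →
          M.IsCriticalPoint b₀ u → u = u₀) ∧
        (∀ u : M.Linf, u ∈ M.strengthDomain → ‖u - (u₀ : M.Linf)‖ ≤ R →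
          M.E b₀ u₀ ≤ M.E b₀ u) ∧
        (∀ u : M.V, (u : M.Linf) ∈ M.strengthDomain → ‖u - u₀‖ ≤ R →
          M.E b₀ u = M.E b₀ u₀ → u = u₀) := by
  obtain ⟨A, K, hK, hA, hD⟩ := M.exists_linearization u₀
  obtain ⟨B, hB⟩ := hu₀.exists_equiv hcone hK hA hD
  obtain ⟨C, hC0, hC⟩ := M.exists_norm_L_sub_sub_le u₀ hD
  set N := ‖(B.symm : M.V →L[ℝ] M.V)‖ with hN
  have hN0 : 0 ≤ N := by
    rw [hN]
    positivity
  have hL₀ : M.L u₀ = b₀ := hcrit.L_eq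
  have hdom := hu₀.mem_strengthDomain
  let f : M.V → M.V := fun u => ⟨M.L u, M.L_mem_V u⟩
  have hf₀ : f u₀ = b₀ := Subtype.ext hL₀
  -- R₀ is chosen so that CRN ≤ 1/2 for R ≤ R₀; the added ones keep the denominator positive when C
  -- or N is 0.
  refine ⟨A - K, B, ?_, hB, 1 / (2 * ((C + 1) * (N + 1))), by positivity, fun R hR hRle => ?_⟩
  · refine hasFDerivAt_of_norm_sub_le_sq (C := C) fun u => ?_
    -- Taking the distance itself as radius makes the Lipschitz estimate quadratic.
    have := hC ‖u - (u₀ : M.Linf)‖ u u₀ le_rfl (by simp)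
    rwa [mul_assoc, ← sq] at this
  have hsmall : C * R * N ≤ 1 / 2 := by
    rw [le_div_iff₀ (by positivity)] at hRle
    have h1 : C * N ≤ (C + 1) * (N + 1) := by gcongr <;> linarith
    nlinarith [mul_le_mul_of_nonneg_left h1 hR.le]
  have happ : ∀ u v : M.V, ‖u - u₀‖ ≤ R → ‖v - u₀‖ ≤ R →
      ‖f u - f v - B (u - v)‖ ≤ C * R * ‖u - v‖ := by
    intro u v hu hv
    have h1 : ((f u - f v - B (u - v) : M.V) : M.Linf) =
        M.L u - M.L v - (A - K) ((u : M.Linf) - v) := by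
      rw [Submodule.coe_sub, Submodule.coe_sub, hB, Submodule.coe_sub]
    have h2 := hC R u v hu hv
    rw [← h1] at h2
    exact h2
  have lift := fun T : ℝ => existsUnique_lift_of_approximatesLinearOn (Z := Set.Icc (0 : ℝ) T)
    hR (by positivity) hsmall happ
  have hself : ‖u₀ - u₀‖ ≤ R := by simpa using hR.le
  refine ⟨fun T _ b hb => ?_, fun u _ huR hu => ?_, fun u hu _ => M.E_le_E_of_L_eq hdom hu hL₀,
    fun u hu _ hE => ?_⟩
  · obtain ⟨u, ⟨h1, h2⟩, h3⟩ := (lift T).2 b (by rwa [hf₀])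
    exact ⟨u, ⟨h1, fun t => congrArg Subtype.val (h2 t)⟩,
      fun v hv => h3 v ⟨hv.1, fun t => Subtype.ext (hv.2 t)⟩⟩
  -- A critical point in V solves the same equation as u₀, and the force is injective on the ball in
  -- V; this part of the lifting result does not depend on the time interval.
  · refine (lift 0).1 u u₀ huR hself (Subtype.ext ?_)
    exact hu.L_eq.trans hL₀.symm
  · have h1 := M.ae_scaledStrain_sub_eq_zero hdom hu hL₀ hE
    have h2 := M.eq_zero_of_mem_V (M.V.sub_mem u.2 u₀.2) h1
    exact Subtype.ext (sub_eq_zero.1 h2)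

end
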